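/- Conventions. Composition is written in diagrammatic order, $f;g$. A ribbon category is a braided monoidal category $(\mathbb C,\otimes,I,\sigma)$ with a natural isomorphism (twist) $\theta_X\colon X\to X$ satisfying $\theta_{X\otimes Y}=\sigma_{X,Y};(\theta_Y\otimes\theta_X);\sigma_{Y,X}$ and with duals $X^*$, $\eta_X\colon I\to X\otimes X^*$, $\varepsilon_X\colon X^*\otimes X\to I$, such that $(\theta_X)^*=\theta_{X^*}$. It has the trace $$\mathit{Tr}^X_{P,Q}(f)=(P\otimes\eta_X);(f\otimes X^*);\bigl(Q\otimes(\sigma_{X,X^*};(X^*\otimes\theta_X);\varepsilon_X)\bigr)\colon P\to Q\qquad (f\colon P\otimes X\to Q\otimes X).$$ A reflexive object is an object $A$ with $\mathsf{app}\colon A\otimes A\to A$ such that for every $f\colon X\otimes A\to A$ there is a unique $\mathsf{cur}(f)\colon X\to A$ with $(\mathsf{cur}(f)\otimes A);\mathsf{app}=f$. Associativity and unit isomorphisms are suppressed below. Let $A$ be a reflexive object of a ribbon category $\mathbb C$. Let $\mathbb C|_A$ be the full subcategory on the tensor powers of $A$: its objects are the natural numbers, its morphisms $m\to n$ are all morphisms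 $A^{\otimes m}\to A^{\otimes n}$ of $\mathbb C$, and its tensor product (with $m\otimes n=m+n$), braiding and twist are those of $\mathbb C$. Let $\mathcal A=\mathbb C(I,A)$ with the application $a\cdot b=(a\otimes b);\mathsf{app}$ and the elements $$B=\mathsf{cur}^3((A\otimes\mathsf{app});\mathsf{app}),\quad \mathbf I=\mathsf{cur}(\mathrm{id}_A),\quad a^\bullet=\mathsf{cur}((A\otimes a);\mathsf{app})\ (a\in\mathcal A),$$ $$C^{\pm}=\mathsf{cur}^3((A\otimes\sigma_{A,A}^{\pm1});(\mathsf{app}\otimes A);\mathsf{app}),\quad \theta^{\pm}=\mathsf{cur}^2((A\otimes\theta_A^{\pm1});\mathsf{app}).$$ Write $a\circ b=(B\cdot a)\cdot b$, let $B^0=\mathbf I$, $B^{k+1}=B\circ B^k$, and say that $a\in\mathcal A$ has arity $m\to n$ if $a^\bullet\circ B^{m+1}=(B\cdot a)\circ B^n$. The internal PROB $\mathcal I_{\mathcal A}$ is the strict braided monoidal category with the natural numbers as objects, the elements of arity $m\to n$ as morphisms $m\to n$, composition $a;b=a\circ b$, identities $\mathbf I$, and tensor product $m\otimes n=m+n$,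 $l\otimes a=B\cdot(B\cdots(B\cdot a))$ ($l$ times), $a\otimes l=a$. Its braiding $\sigma_{m,n}\colon m+n\to n+m$ is the one generated by $\sigma_{1,1}=C^+$, that is, $\sigma_{m,0}=\sigma_{0,1}=\mathbf I$, $\sigma_{m+1,1}=(1\otimes\sigma_{m,1});(\sigma_{1,1}\otimes m)$, $\sigma_{m,n+1}=(\sigma_{m,1}\otimes n);(1\otimes\sigma_{m,n})$, and its twist is $\theta_0=\mathbf I$, $\theta_{m+1}=(\theta^+\otimes m);\sigma_{1,m};(\theta_m\otimes1);\sigma_{m,1}$. Let $\mathsf{app}_0=\mathrm{id}_A$, $\mathsf{app}_{n+1}=(\mathsf{app}\otimes A^{\otimes n});\mathsf{app}_n\colon A^{\otimes(n+2)}\to A$. Let $$\mathsf{lam}=(A\otimes\eta_A);(A\otimes A\otimes\theta_{A^*}^{-1});(A\otimes\sigma_{A^*,A}^{-1});(\mathsf{cur}(A\otimes\varepsilon_A)\otimes A)\colon A\to A\otimes A$$ and $\mathsf{lam}_0=\mathrm{id}_A$, $\mathsf{lam}_{m+1}=\mathsf{lam}_m;(\mathsf{lam}\otimes A^{\otimes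 m})$. Let $F\colon\mathbb C|_A\to\mathcal I_{\mathcal A}$ be the functor which is the identity on objects and sends $f\colon A^{\otimes m}\to A^{\otimes n}$ to $F(f)=\mathsf{cur}^{m+1}((A\otimes f);\mathsf{app}_n)$. Theorem. Suppose that the trivial loop $\bigcirc=\mathit{Tr}^A_{I,I}(\mathrm{id}_A)\colon I\to I$ equals $\mathrm{id}_I$. Then: 1. for all $m,n$ and all $f\colon A^{\otimes m}\to A^{\otimes n}$, $F(f)=\mathit{Tr}^A_{I,A}\bigl(\mathsf{lam}_m;(\mathsf{lam}\otimes f);(A\otimes\mathsf{app}_n)\bigr)$; 2. $F$ is full and faithful, and an equivalence of categories; 3. with the braidings and twists above, both $\mathbb C|_A$ and $\mathcal I_{\mathcal A}$ admit duals that make them ribbon categories, and $F$ is a strict braided monoidal functor that preserves the twist. Hence $F$ is an equivalence of ribbon categories. -/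

import Mathlib

open CategoryTheory MonoidalCategory

/-- The operations of a `BI(_)•`-algebra: a binary application, elements `B` and `I`, and an
element `a•` for every element `a`. -/
class CombinatorData (M : Type*) where
  /-- application -/
  ap : M → M → M
  /-- the combinator `B` -/
  B : M
  /-- the combinator `I` -/
  I : M
  /-- the element `a•` -/
  bul : M → M

namespace CombinatorData

infixl:75 " ⬝ " => CombinatorData.ap

variable {M : Type*} [CombinatorData M]

/-- `a * b` is the composition `a ∘ b = B a b`. -/
instance : Mul M := ⟨fun a b => B ⬝ a ⬝ b⟩

instance : One M := ⟨I⟩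

theorem mul_def (a b : M) : a * b = B ⬝ a ⬝ b := rfl

theorem one_def : (1 : M) = I := rfl

/-- `lft k a = B (B (… (B a)))` with `k` applications of `B`. -/
def lft : ℕ → M → M
  | 0, a => a
  | k + 1, a => B ⬝ lft k a

/-- `Bpow k` is the composite `B ∘ B ∘ … ∘ B` of `k` copies of `B`, with `Bpow 0 = I`. -/
def Bpow : ℕ → M
  | 0 => I
  | k + 1 => B * Bpow k

/-- `HasArity m n a` says that `a` is of arity `m → n`: `a• ∘ B^(m+1) = (B a) ∘ B^n`. -/
def HasArity (m n : ℕ) (a : M) : Prop :=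
  bul a * Bpow (m + 1) = (B ⬝ a) * Bpow n

end CombinatorData

open CombinatorData

/-- Extensional `BI(_)•`-algebras. -/
class ExtBIAlgebra (M : Type*) extends CombinatorData M where
  B_ap : ∀ a b c : M, B ⬝ a ⬝ b ⬝ c = a ⬝ (b ⬝ c)
  I_ap : ∀ a : M, I ⬝ a = a
  bul_ap : ∀ a b : M, bul a ⬝ b = b ⬝ a
  B_I : B ⬝ I = (I : M)
  bul_app : ∀ a b : M, bul (a ⬝ b) = bul b * (bul a * B)
  arity_B : bul B * (B * (B * B)) = (B ⬝ B) * (B : M)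
  arity_I : bul I * B = B ⬝ (I : M)
  arity_bul : ∀ a : M, bul (bul a) * B = (B ⬝ bul a) * B

namespace ExtBIAlgebra

variable {M : Type*} [ExtBIAlgebra M]

theorem mul_ap (a b c : M) : (a * b) ⬝ c = a ⬝ (b ⬝ c) := B_ap a b c

theorem B_mul (a b : M) : B ⬝ (a * b) = (B ⬝ a) * (B ⬝ b) := by
  have h := congrArg (fun x : M => x ⬝ a ⬝ b) (arity_B (M := M))
  simp only [mul_ap, bul_ap, B_ap] at h
  exact h.symm

theorem mul_assoc' (a b c : M) : a * b * c = a * (b * c) := by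
  rw [mul_def (a * b) c, B_mul, mul_ap]; rfl

theorem one_mul' (a : M) : 1 * a = a := by
  rw [mul_def, one_def, B_I, I_ap]

theorem mul_one' (a : M) : a * 1 = a := by
  have h := congrArg (fun x : M => x ⬝ a) (arity_I (M := M))
  simp only [mul_ap, bul_ap, B_I, I_ap] at h
  exact h

instance : Monoid M where
  mul_assoc := mul_assoc'
  one_mul := one_mul'
  mul_one := mul_one'

theorem B_one : B ⬝ (1 : M) = 1 := B_I

theorem lft_zero (a : M) : lft 0 a = a := rfl

theorem lft_succ (k : ℕ) (a : M) : lft (k + 1) a = B ⬝ lft k a := rfl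

theorem lft_one' (a : M) : lft 1 a = B ⬝ a := rfl

theorem lft_mul (k : ℕ) (a b : M) : lft k (a * b) = lft k a * lft k b := by
  induction k with
  | zero => rfl
  | succ k ih => rw [lft_succ, ih, B_mul]; rfl

theorem lft_one (k : ℕ) : lft k (1 : M) = 1 := by
  induction k with
  | zero => rfl
  | succ k ih => rw [lft_succ, ih, B_one]

theorem lft_lft (k l : ℕ) (a : M) : lft k (lft l a) = lft (k + l) a := by
  induction k with
  | zero => simp [lft_zero]
  | succ k ih => rw [lft_succ, ih, Nat.succ_add, lft_succ]

theorem lft_succ' (k : ℕ) (a : M) : lft (k + 1) a = lft k (B ⬝ a) := by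
  rw [← lft_one', lft_lft]

theorem Bpow_add (k l : ℕ) : Bpow (k + l) = Bpow k * (Bpow l : M) := by
  induction k with
  | zero => rw [Nat.zero_add]; exact (one_mul _).symm
  | succ k ih => rw [Nat.succ_add, Bpow, Bpow, ih, mul_assoc]

theorem Bpow_one : Bpow 1 = (B : M) := mul_one' _

theorem Bpow_succ' (k : ℕ) : Bpow (k + 1) = Bpow k * (B : M) := by
  rw [Bpow_add, Bpow_one]

theorem Bpow_ap (k : ℕ) (a : M) : Bpow k ⬝ a = lft k a := by
  induction k with
  | zero => exact I_ap a
  | succ k ih => rw [Bpow, mul_ap, ih]; rfl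

theorem interchange {m n : ℕ} {a : M} (h : HasArity m n a) (b : M) :
    lft m b * a = a * lft n b := by
  have h' := congrArg (fun x : M => x ⬝ b) h
  simp only [mul_ap, bul_ap, Bpow_ap] at h'
  exact h'

theorem arity_one (m : ℕ) : HasArity m m (1 : M) := by
  unfold HasArity
  rw [B_one, one_mul, Bpow, ← mul_assoc]
  have : bul (1 : M) * B = 1 := by rw [one_def, arity_I, B_I]
  rw [this, one_mul]

theorem bul_ap' (a b : M) : bul (a ⬝ b) = bul b * bul a * B := by
  rw [bul_app, mul_assoc]

theorem bul_B_mul : bul B * (B * (B * B)) = (B ⬝ B) * (B : M) := arity_B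

theorem arity_lft_one {m n : ℕ} {a : M} (h : HasArity m n a) :
    HasArity (m + 1) (n + 1) (B ⬝ a) := by
  unfold HasArity at h ⊢
  have e : Bpow (m + 1 + 1) = B * (B * Bpow m : M) := rfl
  have h3 : bul B * (B * (B * (B * Bpow m))) = (B ⬝ B) * (B * Bpow m : M) := by
    have := congrArg (fun x : M => x * Bpow m) (arity_B (M := M))
    simpa only [mul_assoc] using this
  have h4 : (bul a) * (B ⬝ B) = B * bul a := by
    have := interchange (m := 0) (n := 1) (a := bul a) (b := B) (by
      have := arity_bul a
      unfold HasArity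
      simpa [Bpow, ← one_def] using this)
    simpa [lft] using this.symm
  rw [e, bul_app, mul_assoc, mul_assoc, h3, ← mul_assoc, h4, mul_assoc]
  have h5 : bul a * (B * Bpow m) = (B ⬝ a) * Bpow n := h
  rw [h5, Bpow, ← mul_assoc, ← mul_assoc]
  congr 1
  have := interchange (m := 2) (n := 1) (a := (B : M)) (b := a) (by
      unfold HasArity
      simpa [Bpow, ← one_def, mul_assoc] using arity_B (M := M))
  simpa [lft] using this.symm

theorem arity_B' : HasArity 2 1 (B : M) := by
  unfold HasArity
  simpa [Bpow, ← one_def, mul_assoc] using arity_B (M := M)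

theorem arity_bul' (a : M) : HasArity 0 1 (bul a) := by
  have := arity_bul a
  unfold HasArity
  simpa [Bpow, ← one_def] using this

theorem arity_add_one {m n : ℕ} {a : M} (h : HasArity m n a) : HasArity (m + 1) (n + 1) a := by
  unfold HasArity at h ⊢
  rw [Bpow_succ' (m + 1), Bpow_succ' n, ← mul_assoc, h, mul_assoc]

theorem arity_add {m n : ℕ} {a : M} (h : HasArity m n a) (k : ℕ) :
    HasArity (m + k) (n + k) a := by
  induction k with
  | zero => exact h
  | succ k ih => exact arity_add_one ih

theorem arity_lft {m n : ℕ} {a : M} (h : HasArity m n a) (k : ℕ) :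
    HasArity (k + m) (k + n) (lft k a) := by
  induction k with
  | zero => simpa [lft] using h
  | succ k ih => rw [Nat.succ_add, Nat.succ_add]; exact arity_lft_one ih

theorem arity_mul {l m n : ℕ} {a b : M} (ha : HasArity l m a) (hb : HasArity m n b) :
    HasArity l n (a * b) := by
  have h1 : bul (a * b) = bul b * (bul a * (bul B * (B * B))) := by
    rw [mul_def, bul_app, bul_app]; simp only [mul_assoc]
  have h2 : HasArity (l + 1) (m + 1) (B ⬝ a) := arity_lft_one ha
  have h3 := interchange (arity_bul' b) (B ⬝ a)
  have h4 : bul (B ⬝ a) = bul a * (bul B * B) := bul_app _ _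
  unfold HasArity at ha hb h2 ⊢
  rw [h4] at h2
  have h2' : bul a * (bul B * (B * (B * Bpow (l + 1)))) =
    (B ⬝ (B ⬝ a)) * Bpow (m + 1) := by
    rw [← h2, show Bpow (l + 1 + 1) = B * (Bpow (l + 1) : M) from rfl]; simp only [mul_assoc]
  have h3' : (B ⬝ a) * bul b = bul b * (B ⬝ (B ⬝ a)) := h3
  rw [h1]
  simp only [mul_assoc]
  rw [h2', ← mul_assoc, ← h3', mul_assoc, hb, ← mul_assoc, ← B_mul]

end ExtBIAlgebra

/-- Objects of the internal PRO of `M`: natural numbers. -/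
structure InternalPRO (M : Type*) where
  /-- the natural number -/
  len : ℕ

namespace InternalPRO

open ExtBIAlgebra

variable {M : Type*} [ExtBIAlgebra M]

instance : Category (InternalPRO M) where
  Hom X Y := {a : M // HasArity X.len Y.len a}
  id _ := ⟨1, arity_one _⟩
  comp f g := ⟨f.1 * g.1, arity_mul f.2 g.2⟩
  id_comp f := Subtype.ext (one_mul f.1)
  comp_id f := Subtype.ext (mul_one f.1)
  assoc f g h := Subtype.ext (mul_assoc f.1 g.1 h.1)

/-- The element of the algebra underlying a morphism of the internal PRO. -/
def val {X Y : InternalPRO M} (f : X ⟶ Y) : M := f.1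

/-- The morphism of the internal PRO given by an element with an arity. -/
def homMk {X Y : InternalPRO M} (a : M) (h : HasArity X.len Y.len a) : X ⟶ Y := ⟨a, h⟩

@[ext] theorem hom_ext {X Y : InternalPRO M} {f g : X ⟶ Y} (h : val f = val g) : f = g :=
  Subtype.ext h

theorem val_arity {X Y : InternalPRO M} (f : X ⟶ Y) : HasArity X.len Y.len (val f) := f.2

@[simp] theorem val_homMk {X Y : InternalPRO M} (a : M) (h : HasArity X.len Y.len a) :
    val (homMk (X := X) (Y := Y) a h) = a := rfl

@[simp] theorem val_id (X : InternalPRO M) : val (𝟙 X) = 1 := rfl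

@[simp] theorem val_comp {X Y Z : InternalPRO M} (f : X ⟶ Y) (g : Y ⟶ Z) :
    val (f ≫ g) = val f * val g := rfl

/-- Objects of equal length are identified by `I`. -/
def isoOfEq {X Y : InternalPRO M} (h : X.len = Y.len) : X ≅ Y where
  hom := homMk 1 (by rw [h]; exact arity_one _)
  inv := homMk 1 (by rw [h]; exact arity_one _)
  hom_inv_id := by ext; simp
  inv_hom_id := by ext; simp

@[simp] theorem val_isoOfEq_hom {X Y : InternalPRO M} (h : X.len = Y.len) :
    val (isoOfEq (M := M) h).hom = 1 := rfl

@[simp] theorem val_isoOfEq_inv {X Y : InternalPRO M} (h : X.len = Y.len) :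
    val (isoOfEq (M := M) h).inv = 1 := rfl

/-- The monoidal structure: `m + n` on objects, `l + a = B^l a` and `a + l = a` on morphisms. -/
instance : MonoidalCategoryStruct (InternalPRO M) where
  tensorObj X Y := ⟨X.len + Y.len⟩
  tensorUnit := ⟨0⟩
  whiskerLeft X _ _ f := homMk (lft X.len (val f)) (arity_lft (val_arity f) _)
  whiskerRight f Y := homMk (val f) (arity_add (val_arity f) Y.len)
  tensorHom {_ Y₁ X₂ _} f g := homMk (val f * lft Y₁.len (val g))
    (arity_mul (arity_add (val_arity f) X₂.len) (arity_lft (val_arity g) _))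
  associator X Y Z := isoOfEq (Nat.add_assoc X.len Y.len Z.len)
  leftUnitor X := isoOfEq (Nat.zero_add X.len)
  rightUnitor X := isoOfEq (Nat.add_zero X.len)

@[simp] theorem len_tensor (X Y : InternalPRO M) : (X ⊗ Y).len = X.len + Y.len := rfl
@[simp] theorem len_unit : (𝟙_ (InternalPRO M)).len = 0 := rfl
@[simp] theorem val_whiskerLeft (X : InternalPRO M) {Y Z : InternalPRO M} (f : Y ⟶ Z) :
    val (X ◁ f) = lft X.len (val f) := rfl
@[simp] theorem val_whiskerRight {X Y : InternalPRO M} (f : X ⟶ Y) (Z : InternalPRO M) :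
    val (f ▷ Z) = val f := rfl
@[simp] theorem val_tensorHom {X₁ X₂ Y₁ Y₂ : InternalPRO M} (f : X₁ ⟶ Y₁) (g : X₂ ⟶ Y₂) :
    val (f ⊗ₘ g) = val f * lft Y₁.len (val g) := rfl
@[simp] theorem val_associator_hom (X Y Z : InternalPRO M) : val (α_ X Y Z).hom = 1 := rfl
@[simp] theorem val_associator_inv (X Y Z : InternalPRO M) : val (α_ X Y Z).inv = 1 := rfl
@[simp] theorem val_leftUnitor_hom (X : InternalPRO M) : val (λ_ X).hom = 1 := rfl
@[simp] theorem val_leftUnitor_inv (X : InternalPRO M) : val (λ_ X).inv = 1 := rfl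
@[simp] theorem val_rightUnitor_hom (X : InternalPRO M) : val (ρ_ X).hom = 1 := rfl
@[simp] theorem val_rightUnitor_inv (X : InternalPRO M) : val (ρ_ X).inv = 1 := rfl

instance : MonoidalCategory (InternalPRO M) where
  tensorHom_def f g := by ext; simp
  id_tensorHom_id X Y := by ext; simp [lft_one]
  tensorHom_comp_tensorHom {X₁ Y₁ Z₁ X₂ Y₂ Z₂} f₁ f₂ g₁ g₂ := by
    ext
    simp only [val_comp, val_tensorHom, lft_mul, mul_assoc]
    rw [← mul_assoc (lft _ (val f₂)), interchange (val_arity g₁) (val f₂), mul_assoc]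
  whiskerLeft_id X Y := by ext; simp [lft_one]
  id_whiskerRight X Y := by ext; simp
  associator_naturality f₁ f₂ f₃ := by
    ext; simp [lft_mul, lft_lft, mul_assoc]
  leftUnitor_naturality f := by ext; simp [lft_zero]
  rightUnitor_naturality f := by ext; simp
  pentagon W X Y Z := by ext; simp [lft_one]
  triangle X Y := by ext; simp [lft_one]

end InternalPRO

namespace CombinatorData

variable {M : Type*} [CombinatorData M]

/-- `braidOne c m : m + 1 → 1 + m` -/
def braidOne (c : M) : ℕ → M
  | 0 => 1
  | m + 1 => (B ⬝ braidOne c m) * c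

/-- `braid c m n : m + n → n + m` -/
def braid (c : M) (m : ℕ) : ℕ → M
  | 0 => 1
  | n + 1 => braidOne c m * (B ⬝ braid c m n)

/-- `twistElt c t m : m → m` -/
def twistElt (c t : M) : ℕ → M
  | 0 => 1
  | m + 1 => t * braid c 1 m * twistElt c t m * braid c m 1

end CombinatorData

/-- Balanced extensional braided algebras: the axioms say that `C⁺`, `C⁻` are mutually inverse
elements of arity `2 → 2` that satisfy the Yang-Baxter equation and are natural with respect to `B`
and all `a•`, and that `θ⁺`, `θ⁻` are mutually inverse elements of arity `1 → 1` that are natural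
with respect to `B` and all `a•`. -/
class BalancedExtBIAlgebra (M : Type*) extends ExtBIAlgebra M where
  /-- the combinator `C⁺` -/
  Cp : M
  /-- the combinator `C⁻` -/
  Cm : M
  /-- the combinator `θ⁺` -/
  θp : M
  /-- the combinator `θ⁻` -/
  θm : M
  arity_Cp : HasArity 2 2 Cp
  arity_Cm : HasArity 2 2 Cm
  Cp_Cm : Cp * Cm = (1 : M)
  Cm_Cp : Cm * Cp = (1 : M)
  yang_baxter_Cp : (B ⬝ Cp) * (Cp * (B ⬝ Cp)) = Cp * ((B ⬝ Cp) * Cp)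
  yang_baxter_Cm : (B ⬝ Cm) * (Cm * (B ⬝ Cm)) = Cm * ((B ⬝ Cm) * Cm)
  B_Cp : (B ⬝ B) * Cp = Cp * ((B ⬝ Cp) * B)
  B_Cm : (B ⬝ B) * Cm = Cm * ((B ⬝ Cm) * B)
  bul_Cp : ∀ a : M, (B ⬝ bul a) * Cp = bul a
  bul_Cm : ∀ a : M, (B ⬝ bul a) * Cm = bul a
  arity_θp : HasArity 1 1 θp
  arity_θm : HasArity 1 1 θm
  θp_θm : θp * θm = (1 : M)
  θm_θp : θm * θp = (1 : M)
  bul_θp : ∀ a : M, bul a * θp = bul a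
  bul_θm : ∀ a : M, bul a * θm = bul a
  B_θp : B * θp = θp * Cp * θp * Cp * B
  B_θm : B * θm = θm * Cm * θm * Cm * B

namespace BalancedExtBIAlgebra

open ExtBIAlgebra

section Braid

variable {M : Type*} [ExtBIAlgebra M]

/-- The axioms on a pair of mutually inverse braid combinators. -/
structure IsBraidPair (c d : M) : Prop where
  arity_c : HasArity 2 2 c
  arity_d : HasArity 2 2 d
  cd : c * d = 1
  dc : d * c = 1
  B_c : (B ⬝ B) * c = c * ((B ⬝ c) * B)
  B_d : (B ⬝ B) * d = d * ((B ⬝ d) * B)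
  bul_c : ∀ a : M, (B ⬝ bul a) * c = bul a
  bul_d : ∀ a : M, (B ⬝ bul a) * d = bul a

theorem IsBraidPair.symm {c d : M} (h : IsBraidPair c d) : IsBraidPair d c :=
  ⟨h.arity_d, h.arity_c, h.dc, h.cd, h.B_d, h.B_c, h.bul_d, h.bul_c⟩

theorem braidOne_arity {c : M} (h : HasArity 2 2 c) (m : ℕ) :
    HasArity (m + 1) (1 + m) (braidOne c m) := by
  induction m with
  | zero => exact arity_one _
  | succ m ih =>
    refine arity_mul (m := m + 2) (arity_lft_one ih |> fun x => ?_) ?_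
    · exact (by simpa [Nat.add_comm, Nat.add_left_comm, Nat.add_assoc] using x)
    · have := arity_add h m
      simpa [Nat.add_comm, Nat.add_left_comm, Nat.add_assoc] using this

theorem braid_arity {c : M} (h : HasArity 2 2 c) (m n : ℕ) :
    HasArity (m + n) (n + m) (braid c m n) := by
  induction n with
  | zero => simpa [braid] using arity_one m
  | succ n ih =>
    refine arity_mul (m := m + n + 1) ?_ ?_
    · have := arity_add (braidOne_arity h m) n
      simpa [Nat.add_comm, Nat.add_left_comm, Nat.add_assoc] using this
    · have := arity_lft_one ih
      simpa [Nat.add_comm, Nat.add_left_comm, Nat.add_assoc] using this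

theorem braid_zero_right (c : M) (m : ℕ) : braid c m 0 = 1 := rfl

theorem braid_one_right (c : M) (m : ℕ) : braid c m 1 = braidOne c m := by
  simp [braid, B_one]

theorem braid_zero_left (c : M) (n : ℕ) : braid c 0 n = 1 := by
  induction n with
  | zero => rfl
  | succ n ih => simp [braid, braidOne, ih, B_one]

theorem braid_one_one (c : M) : braid c 1 1 = c := by
  simp [braid, braidOne, B_one]

theorem braid_add_right (c : M) (m n k : ℕ) :
    braid c m (n + k) = braid c m n * lft n (braid c m k) := by
  induction n with
  | zero => simp [braid, lft]
  | succ n ih => rw [Nat.succ_add, braid, ih, B_mul, braid, mul_assoc]; rfl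

theorem braid_one_succ (c : M) (n : ℕ) : braid c 1 (n + 1) = c * (B ⬝ braid c 1 n) := by
  rw [Nat.add_comm, braid_add_right, braid_one_one]; rfl

theorem braidOne_add (c : M) (m n : ℕ) :
    braidOne c (m + n) = lft m (braidOne c n) * braidOne c m := by
  induction m with
  | zero => simp [braidOne, lft]
  | succ m ih => rw [Nat.succ_add, braidOne, ih, B_mul, braidOne, mul_assoc]; rfl

theorem braid_add_left {c : M} (h : HasArity 2 2 c) (m n k : ℕ) :
    braid c (m + n) k = lft m (braid c n k) * braid c m k := by
  induction k with
  | zero => simp [braid, lft_one]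
  | succ k ih =>
    have e := interchange (braidOne_arity h m) (braid c n k)
    rw [Nat.add_comm 1 m] at e
    rw [braid, ih, braidOne_add, braid, braid, lft_mul, B_mul]
    calc lft m (braidOne c n) * braidOne c m * (B ⬝ lft m (braid c n k) * B ⬝ braid c m k)
        = lft m (braidOne c n) * (braidOne c m * lft (m + 1) (braid c n k)) *
            B ⬝ braid c m k := by simp only [mul_assoc, lft_succ]
      _ = _ := by rw [← e, lft_succ']; simp only [mul_assoc]

theorem braid_mul_braid {c d : M} (h : IsBraidPair c d) (m n : ℕ) :
    braid c m n * braid d n m = 1 := by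
  have h1 : ∀ m, braidOne c m * braid d 1 m = 1 := by
    intro m
    induction m with
    | zero => simp [braidOne, braid]
    | succ m ih =>
      rw [braidOne, braid_one_succ, mul_assoc, ← mul_assoc c, h.cd, one_mul, ← B_mul, ih, B_one]
  induction n with
  | zero => rw [braid_zero_left, braid, one_mul]
  | succ n ih =>
    rw [Nat.add_comm n 1, braid_add_left h.arity_d, Nat.add_comm 1 n, braid, mul_assoc,
      ← mul_assoc (B ⬝ _), lft_one', ← B_mul, ih, B_one, one_mul, h1]

/-- Naturality of `braid c 1 _` with respect to `b : n → n'`. -/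
def NatR (c : M) (n n' : ℕ) (b : M) : Prop :=
  HasArity n n' b ∧ (B ⬝ b) * braid c 1 n' = braid c 1 n * b

theorem NatR.mul {c : M} {l m n : ℕ} {a b : M} (ha : NatR c l m a) (hb : NatR c m n b) :
    NatR c l n (a * b) :=
  ⟨arity_mul ha.1 hb.1, by rw [B_mul, mul_assoc, hb.2, ← mul_assoc, ha.2, mul_assoc]⟩

theorem NatR.add {c : M} {m n : ℕ} {a : M} (ha : NatR c m n a) (k : ℕ) :
    NatR c (m + k) (n + k) a :=
  ⟨arity_add ha.1 k, by
    rw [braid_add_right, braid_add_right, ← mul_assoc, ha.2, mul_assoc, mul_assoc,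
      interchange ha.1]⟩

theorem natR_Bpow {c d : M} (h : IsBraidPair c d) (n : ℕ) : NatR c (n + 1) 1 (Bpow n) := by
  have hB : NatR c 2 1 B := ⟨arity_B', by
    rw [braid_one_one, braid_one_succ, braid_one_one, mul_assoc]; exact h.B_c⟩
  induction n with
  | zero => exact ⟨arity_one _, by simp [Bpow, ← one_def, B_one]⟩
  | succ n ih =>
    have := hB.add n
    exact NatR.mul (m := n + 1) (by simpa [Nat.add_comm, Nat.add_left_comm, Nat.add_assoc]
      using this) ih

theorem natR_bul {c d : M} (h : IsBraidPair c d) (a : M) : NatR c 0 1 (bul a) :=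
  ⟨arity_bul' a, by rw [braid_one_one, braid, one_mul]; exact h.bul_c a⟩

theorem lft_Bpow_cancel {n : ℕ} {a b : M} (h : (B ⬝ a) * Bpow n = (B ⬝ b) * Bpow n) : a = b := by
  have h' := congrArg (fun x : M => x ⬝ I) h
  have e : lft n (I : M) = 1 := lft_one n
  simp only [mul_ap, Bpow_ap, e] at h'
  have e1 : ∀ a : M, B ⬝ a ⬝ 1 = a := fun a => mul_one a
  rwa [e1, e1] at h'

theorem natR {c d : M} (h : IsBraidPair c d) {m n : ℕ} {a : M} (ha : HasArity m n a) :
    NatR c m n a := by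
  refine ⟨ha, ?_⟩
  have h1 : NatR c (m + 1) 1 ((B ⬝ a) * Bpow n) := by
    have e : (B ⬝ a) * Bpow n = bul a * Bpow (m + 1) := ha.symm
    rw [e]
    have := (natR_bul h a).add (m + 1)
    refine NatR.mul (m := m + 2) ?_ (natR_Bpow h (m + 1))
    simpa [Nat.add_comm, Nat.add_left_comm, Nat.add_assoc] using this
  have h2 := h1.2
  have h3 := (natR_Bpow h n).2
  rw [B_mul, mul_assoc, h3, braid_one_succ, braid_one_succ] at h2
  have h4 : (B ⬝ (B ⬝ a)) * c = c * (B ⬝ (B ⬝ a)) := by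
    have := interchange h.arity_c a
    simpa [lft] using this
  have h5 : c * ((B ⬝ ((B ⬝ a) * braid c 1 n)) * Bpow n) =
      c * ((B ⬝ (braid c 1 m * a)) * Bpow n) := by
    rw [B_mul, B_mul]
    calc _ = (c * (B ⬝ (B ⬝ a))) * (B ⬝ braid c 1 n) * Bpow n := by simp only [mul_assoc]
      _ = _ := by rw [← h4]; simpa only [mul_assoc] using h2
  have h6 := congrArg (fun x => d * x) h5
  simp only [← mul_assoc d, h.dc, one_mul] at h6
  exact lft_Bpow_cancel h6

theorem IsBraidPair.yang_baxter {c d : M} (h : IsBraidPair c d) :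
    (B ⬝ c) * (c * (B ⬝ c)) = c * ((B ⬝ c) * c) := by
  have := (natR h h.arity_c).2
  rwa [braid_one_succ, braid_one_one, mul_assoc] at this

theorem braid_natural_right {c d : M} (h : IsBraidPair c d) {n n' : ℕ} {b : M}
    (hb : HasArity n n' b) (m : ℕ) : lft m b * braid c m n' = braid c m n * b := by
  induction m with
  | zero => simp [lft, braid_zero_left]
  | succ m ih =>
    rw [braid_add_left h.arity_c, braid_add_left h.arity_c, lft_succ', ← mul_assoc, ← lft_mul,
      (natR h hb).2, lft_mul, mul_assoc, ih, mul_assoc]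

theorem braid_natural_left {c d : M} (h : IsBraidPair c d) {m m' : ℕ} {a : M}
    (ha : HasArity m m' a) (n : ℕ) : a * braid c m' n = braid c m n * lft n a := by
  have h1 := braid_natural_right h.symm ha n
  calc a * braid c m' n
      = braid c m n * (braid d n m * a) * braid c m' n := by
        rw [← mul_assoc, braid_mul_braid h, one_mul]
    _ = braid c m n * lft n a * (braid d n m' * braid c m' n) := by
        rw [← h1]; simp only [mul_assoc]
    _ = _ := by rw [braid_mul_braid h.symm, mul_one]

/-- The axioms on a twist combinator over a pair of braid combinators. -/
structure IsTwistPair (c d t s : M) : Prop extends IsBraidPair c d where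
  arity_t : HasArity 1 1 t
  arity_s : HasArity 1 1 s
  ts : t * s = 1
  st : s * t = 1
  bul_t : ∀ a : M, bul a * t = bul a
  bul_s : ∀ a : M, bul a * s = bul a
  B_t : B * t = t * c * t * c * B
  B_s : B * s = s * d * s * d * B

theorem IsTwistPair.symm {c d t s : M} (h : IsTwistPair c d t s) : IsTwistPair d c s t :=
  ⟨h.toIsBraidPair.symm, h.arity_s, h.arity_t, h.st, h.ts, h.bul_s, h.bul_t, h.B_s, h.B_t⟩

theorem twist_arity {c d t s : M} (h : IsTwistPair c d t s) (m : ℕ) :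
    HasArity m m (twistElt c t m) := by
  induction m with
  | zero => exact arity_one _
  | succ m ih =>
    have h1 := braid_arity h.arity_c 1 m
    have h2 := braid_arity h.arity_c m 1
    have h3 := arity_add h.arity_t m
    rw [Nat.add_comm 1 m] at h1 h2 h3
    exact arity_mul (arity_mul (arity_mul h3 h1) (arity_add_one ih)) h2

/-- the double braiding -/
def dbl (c : M) (m n : ℕ) : M := braid c m n * braid c n m

theorem dbl_natural_right {c d : M} (h : IsBraidPair c d) {n n' : ℕ} {b : M}
    (hb : HasArity n n' b) (m : ℕ) : lft m b * dbl c m n' = dbl c m n * lft m b := by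
  rw [dbl, dbl, ← mul_assoc, braid_natural_right h hb, mul_assoc, braid_natural_left h hb,
    mul_assoc]

theorem dbl_natural_left {c d : M} (h : IsBraidPair c d) {m m' : ℕ} {a : M}
    (ha : HasArity m m' a) (n : ℕ) : a * dbl c m' n = dbl c m n * a := by
  rw [dbl, dbl, ← mul_assoc, braid_natural_left h ha, mul_assoc, braid_natural_right h ha,
    mul_assoc]

theorem dbl_arity {c : M} (h : HasArity 2 2 c) (m n : ℕ) :
    HasArity (m + n) (m + n) (dbl c m n) :=
  arity_mul (braid_arity h m n) (braid_arity h n m)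

theorem twist_succ {c d t s : M} (h : IsTwistPair c d t s) (m : ℕ) :
    twistElt c t (m + 1) = t * (B ⬝ twistElt c t m) * dbl c 1 m := by
  rw [twistElt, mul_assoc t, ← (natR h.toIsBraidPair (twist_arity h m)).2, dbl]
  simp only [mul_assoc]

theorem twist_one (c t : M) : twistElt c t 1 = t := by
  simp [twistElt, braid, braidOne, B_one]

theorem dbl_one_add {c d : M} (h : IsBraidPair c d) (m n : ℕ) :
    (B ⬝ dbl c m n) * dbl c 1 (m + n) =
      dbl c 1 m * (B ⬝ braid c m n) * dbl c 1 n * (B ⬝ braid c n m) := by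
  have h1 := dbl_natural_right h (braid_arity h.arity_c m n) 1
  have h2 := dbl_natural_right h (braid_arity h.arity_c n m) 1
  have e1 : dbl c 1 (m + n) = braid c 1 m * lft m (dbl c 1 n) * braid c m 1 := by
    rw [dbl, braid_add_right, braid_add_left h.arity_c, dbl, lft_mul]
    simp only [mul_assoc]
  have e2 : braid c m 1 * (B ⬝ braid c m n) = braid c m (1 + n) := by
    rw [braid_add_right]; rfl
  have e3 : lft m (dbl c 1 n) * braid c m (1 + n) = braid c m (1 + n) * dbl c 1 n :=
    braid_natural_right h (dbl_arity h.arity_c 1 n) m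
  simp only [lft_one'] at h1 h2
  calc (B ⬝ dbl c m n) * dbl c 1 (m + n)
      = (B ⬝ braid c m n) * ((B ⬝ braid c n m) * dbl c 1 (m + n)) := by
        rw [dbl, B_mul, mul_assoc]
    _ = dbl c 1 (m + n) * (B ⬝ braid c m n) * (B ⬝ braid c n m) := by
        rw [h2, ← mul_assoc, h1]
    _ = braid c 1 m * (lft m (dbl c 1 n) * (braid c m 1 * (B ⬝ braid c m n))) *
          (B ⬝ braid c n m) := by rw [e1]; simp only [mul_assoc]
    _ = _ := by
        rw [e2, e3, ← e2, dbl, dbl]; simp only [mul_assoc]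

theorem twist_add {c d t s : M} (h : IsTwistPair c d t s) (m n : ℕ) :
    twistElt c t (m + n) = twistElt c t m * lft m (twistElt c t n) * dbl c m n := by
  have hb := h.toIsBraidPair
  induction m with
  | zero => simp [twistElt, lft, dbl, braid_zero_left, braid]
  | succ m ih =>
    have e1 : dbl c (m + 1) n = (B ⬝ braid c m n) * dbl c 1 n * (B ⬝ braid c n m) := by
      rw [dbl, Nat.add_comm m 1, braid_add_left h.arity_c, braid_add_right, dbl]
      simp only [mul_assoc, lft_one']
    have e2 : lft (m + 1) (twistElt c t n) * dbl c 1 m = dbl c 1 m * lft (m + 1) (twistElt c t n) := by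
      have := interchange (dbl_arity h.arity_c 1 m) (twistElt c t n)
      rwa [Nat.add_comm 1 m] at this
    have e3 := dbl_one_add hb m n
    rw [show m + 1 + n = m + n + 1 by omega, twist_succ h, ih, twist_succ h, e1]
    calc _ = t * (B ⬝ twistElt c t m) * lft (m + 1) (twistElt c t n) *
          ((B ⬝ dbl c m n) * dbl c 1 (m + n)) := by
            rw [B_mul, B_mul, lft_succ]; simp only [mul_assoc]
      _ = t * (B ⬝ twistElt c t m) * (lft (m + 1) (twistElt c t n) * dbl c 1 m) *
          ((B ⬝ braid c m n) * dbl c 1 n * (B ⬝ braid c n m)) := by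
            rw [e3]; simp only [mul_assoc]
      _ = _ := by rw [e2]; simp only [mul_assoc]

theorem twist_mul_twist {c d t s : M} (h : IsTwistPair c d t s) (m : ℕ) :
    twistElt c t m * twistElt d s m = 1 := by
  have hb := h.toIsBraidPair
  induction m with
  | zero => simp [twistElt]
  | succ m ih =>
    have e1 := dbl_natural_left hb.symm h.arity_s m
    have e2 := interchange h.arity_s (twistElt d s m)
    have e3 := (dbl_natural_right hb.symm (twist_arity h.symm m) 1)
    have e4 : dbl c 1 m * dbl d 1 m = 1 := by
      rw [dbl, dbl, mul_assoc, ← mul_assoc (braid c m 1), braid_mul_braid hb, one_mul,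
        braid_mul_braid hb]
    simp only [lft_one'] at e2 e3
    rw [twist_succ h, twist_succ h.symm]
    calc _ = t * (B ⬝ twistElt c t m) * dbl c 1 m * (s * ((B ⬝ twistElt d s m) * dbl d 1 m)) := by
          simp only [mul_assoc]
      _ = t * (B ⬝ twistElt c t m) * (dbl c 1 m * dbl d 1 m) * (B ⬝ twistElt d s m) * s := by
          rw [e3, ← mul_assoc s, e1, mul_assoc (dbl d 1 m), ← e2]; simp only [mul_assoc]
      _ = t * (B ⬝ (twistElt c t m * twistElt d s m)) * s := by
          rw [e4, B_mul]; simp only [mul_assoc, mul_one]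
      _ = 1 := by rw [ih, B_one, mul_one, h.ts]

/-- Naturality of the twist with respect to `a : m → n`. -/
def NatT (c t : M) (m n : ℕ) (a : M) : Prop :=
  HasArity m n a ∧ a * twistElt c t n = twistElt c t m * a

theorem NatT.mul {c t : M} {l m n : ℕ} {a b : M} (ha : NatT c t l m a) (hb : NatT c t m n b) :
    NatT c t l n (a * b) :=
  ⟨arity_mul ha.1 hb.1, by rw [mul_assoc, hb.2, ← mul_assoc, ha.2, mul_assoc]⟩

theorem NatT.add {c d t s : M} (h : IsTwistPair c d t s) {m n : ℕ} {a : M}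
    (ha : NatT c t m n a) (k : ℕ) : NatT c t (m + k) (n + k) a :=
  ⟨arity_add ha.1 k, by
    rw [twist_add h, twist_add h, ← mul_assoc, ← mul_assoc, ha.2, mul_assoc _ a,
      ← interchange ha.1, mul_assoc _ _ (dbl c n k), mul_assoc _ a,
      dbl_natural_left h.toIsBraidPair ha.1]
    simp only [mul_assoc]⟩

theorem natT_Bpow {c d t s : M} (h : IsTwistPair c d t s) (n : ℕ) :
    NatT c t (n + 1) 1 (Bpow n) := by
  have hB : NatT c t 2 1 B := ⟨arity_B', by
    rw [twist_one, h.B_t, twistElt, braid_one_one, twist_one]⟩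
  induction n with
  | zero => exact ⟨arity_one _, by simp [Bpow, ← one_def]⟩
  | succ n ih =>
    have := hB.add h n
    exact NatT.mul (m := n + 1) (by simpa [Nat.add_comm, Nat.add_left_comm, Nat.add_assoc]
      using this) ih

theorem natT_bul {c d t s : M} (h : IsTwistPair c d t s) (a : M) : NatT c t 0 1 (bul a) :=
  ⟨arity_bul' a, by rw [twist_one, twistElt, one_mul]; exact h.bul_t a⟩

theorem twist_natural {c d t s : M} (h : IsTwistPair c d t s) {m n : ℕ} {a : M}
    (ha : HasArity m n a) : a * twistElt c t n = twistElt c t m * a := by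
  have hb := h.toIsBraidPair
  have h1 : NatT c t (m + 1) 1 ((B ⬝ a) * Bpow n) := by
    have e : (B ⬝ a) * Bpow n = bul a * Bpow (m + 1) := ha.symm
    rw [e]
    have := (natT_bul h a).add h (m + 1)
    refine NatT.mul (m := m + 2) ?_ (natT_Bpow h (m + 1))
    simpa [Nat.add_comm, Nat.add_left_comm, Nat.add_assoc] using this
  have h2 := h1.2
  rw [mul_assoc, (natT_Bpow h n).2, twist_succ h, twist_succ h] at h2
  have e1 := interchange h.arity_t a
  have e2 := dbl_natural_right hb ha 1
  have e3 := dbl_natural_right hb (arity_mul ha (twist_arity h n)) 1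
  have e4 := dbl_natural_right hb (arity_mul (twist_arity h m) ha) 1
  simp only [lft_one'] at e1 e2 e3 e4
  have h3 : t * dbl c 1 m * ((B ⬝ (a * twistElt c t n)) * Bpow n) =
      t * dbl c 1 m * ((B ⬝ (twistElt c t m * a)) * Bpow n) := by
    rw [mul_assoc, ← mul_assoc (dbl c 1 m), ← e3, mul_assoc t, ← mul_assoc (dbl c 1 m), ← e4,
      B_mul, B_mul]
    calc _ = (t * (B ⬝ a)) * (B ⬝ twistElt c t n) * dbl c 1 n * Bpow n := by
          simp only [mul_assoc]
      _ = (B ⬝ a) * (t * (B ⬝ twistElt c t n) * dbl c 1 n * Bpow n) := by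
          rw [← e1]; simp only [mul_assoc]
      _ = t * (B ⬝ twistElt c t m) * dbl c 1 m * ((B ⬝ a) * Bpow n) := h2
      _ = t * (B ⬝ twistElt c t m) * (dbl c 1 m * (B ⬝ a)) * Bpow n := by simp only [mul_assoc]
      _ = _ := by rw [← e2]; simp only [mul_assoc]
  have e5 : dbl d 1 m * s * (t * dbl c 1 m) = 1 := by
    rw [mul_assoc, ← mul_assoc s, h.st, one_mul, dbl, dbl, mul_assoc, ← mul_assoc (braid d m 1),
      braid_mul_braid hb.symm, one_mul, braid_mul_braid hb.symm]
  have h4 : dbl d 1 m * s * (t * dbl c 1 m) * ((B ⬝ (a * twistElt c t n)) * Bpow n) =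
      dbl d 1 m * s * (t * dbl c 1 m) * ((B ⬝ (twistElt c t m * a)) * Bpow n) := by
    rw [mul_assoc _ (t * dbl c 1 m), h3, ← mul_assoc]
  rw [e5, one_mul, one_mul] at h4
  exact lft_Bpow_cancel h4

end Braid

variable {M : Type*} [BalancedExtBIAlgebra M]

theorem twistPair : IsTwistPair (Cp : M) Cm θp
    θm :=
  ⟨⟨arity_Cp, arity_Cm, Cp_Cm, Cm_Cp, B_Cp, B_Cm, bul_Cp, bul_Cm⟩, arity_θp, arity_θm, θp_θm,
    θm_θp, bul_θp, bul_θm, B_θp, B_θm⟩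

theorem braidPair : IsBraidPair (Cp : M) Cm :=
  twistPair.toIsBraidPair

end BalancedExtBIAlgebra

/-- A twist on a braided monoidal category. -/
class BalancedCategory (C : Type*) [Category C] [MonoidalCategory C] [BraidedCategory C] where
  /-- the twist `θ_X : X ≅ X` -/
  twist : ∀ X : C, X ≅ X
  twist_naturality : ∀ {X Y : C} (f : X ⟶ Y), f ≫ (twist Y).hom = (twist X).hom ≫ f
  twist_tensor : ∀ X Y : C, (twist (X ⊗ Y)).hom =
    (β_ X Y).hom ≫ ((twist Y).hom ⊗ₘ (twist X).hom) ≫ (β_ Y X).hom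

namespace InternalPRO

open ExtBIAlgebra BalancedExtBIAlgebra

variable {M : Type*} [BalancedExtBIAlgebra M]

/-- The internal PRO is a PROB: its braiding is `σ_{m,n}`, generated by `σ_{1,1} = C⁺`. -/
instance : BraidedCategory (InternalPRO M) where
  braiding X Y :=
    { hom := homMk (braid Cp X.len Y.len) (braid_arity arity_Cp _ _)
      inv := homMk (braid Cm Y.len X.len) (braid_arity arity_Cm _ _)
      hom_inv_id := by ext; simpa using braid_mul_braid braidPair _ _
      inv_hom_id := by ext; simpa using braid_mul_braid braidPair.symm _ _ }
  braiding_naturality_right X Y Z f := by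
    ext; simpa using braid_natural_right braidPair (val_arity f) X.len
  braiding_naturality_left f Z := by
    ext; simpa using braid_natural_left braidPair (val_arity f) Z.len
  hexagon_forward X Y Z := by
    ext; simpa using braid_add_right _ _ _ _
  hexagon_reverse X Y Z := by
    ext; simpa using braid_add_left arity_Cp _ _ _

@[simp] theorem val_braiding_hom (X Y : InternalPRO M) :
    val (β_ X Y).hom = braid Cp X.len Y.len := rfl

/-- The internal PROB is balanced: its twist `θ_m` is generated by `θ_1 = θ⁺`. -/
instance : BalancedCategory (InternalPRO M) where
  twist X :=
    { hom := homMk (twistElt Cp θp X.len) (twist_arity twistPair _)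
      inv := homMk (twistElt Cm θm X.len) (twist_arity twistPair.symm _)
      hom_inv_id := by ext; simpa using twist_mul_twist twistPair _
      inv_hom_id := by ext; simpa using twist_mul_twist twistPair.symm _ }
  twist_naturality f := by
    ext; simpa using twist_natural twistPair (val_arity f)
  twist_tensor X Y := by
    ext
    have h := twistPair (M := M)
    have hb := h.toIsBraidPair
    simp only [val_homMk, val_comp, val_braiding_hom, val_tensorHom, len_tensor]
    have e1 := braid_natural_left hb (twist_arity h X.len) Y.len
    have e2 := braid_natural_right hb (twist_arity h Y.len) X.len
    have e3 := interchange (twist_arity h Y.len) (twistElt Cp θp X.len)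
    rw [twist_add h, dbl, ← e3]
    calc _ = twistElt Cp θp X.len * (lft X.len (twistElt Cp θp Y.len) * braid Cp X.len Y.len) *
          braid Cp Y.len X.len := by simp only [mul_assoc]
      _ = (twistElt Cp θp X.len * braid Cp X.len Y.len) * twistElt Cp θp Y.len *
          braid Cp Y.len X.len := by rw [e2]; simp only [mul_assoc]
      _ = _ := by rw [e1]; simp only [mul_assoc]

end InternalPRO

section Reflexive

variable {C : Type*} [Category C] [MonoidalCategory C]

/-- A reflexive object of a monoidal category: an object `A` with a morphism `app : A ⊗ A ⟶ A` such
that every `f : X ⊗ A ⟶ A` is `(cur f ⊗ A) ; app` for a unique morphism `cur f : X ⟶ A`. -/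
structure ReflexiveObject (A : C) where
  /-- application -/
  app : A ⊗ A ⟶ A
  /-- currying -/
  cur : ∀ {X : C}, (X ⊗ A ⟶ A) → (X ⟶ A)
  cur_app : ∀ {X : C} (f : X ⊗ A ⟶ A), cur f ▷ A ≫ app = f
  cur_unique : ∀ {X : C} (f : X ⊗ A ⟶ A) (g : X ⟶ A), g ▷ A ≫ app = f → g = cur f

/-- The tensor power `A^{⊗ n}`. -/
def tensorPow (A : C) : ℕ → C
  | 0 => 𝟙_ C
  | n + 1 => tensorPow A n ⊗ A

namespace ReflexiveObject

variable {A : C} (R : ReflexiveObject A)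

attribute [simp] cur_app

theorem ext_app {X : C} {g h : X ⟶ A} (e : g ▷ A ≫ R.app = h ▷ A ≫ R.app) : g = h := by
  rw [R.cur_unique _ g e, ← R.cur_unique _ h rfl]

/-- `app_n : A ⊗ A^{⊗ n} ⟶ A`, with `app_0 = id` and `app_{n+1} = (app_n ⊗ A) ; app`. -/
def appN : ∀ n : ℕ, A ⊗ tensorPow A n ⟶ A
  | 0 => (ρ_ A).hom
  | n + 1 => (α_ A (tensorPow A n) A).inv ≫ appN n ▷ A ≫ R.app

/-- `cur^n`, from `X ⊗ A^{⊗ n} ⟶ A` to `X ⟶ A` -/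
def curN : ∀ (n : ℕ) {X : C}, (X ⊗ tensorPow A n ⟶ A) → (X ⟶ A)
  | 0, X, f => (ρ_ X).inv ≫ f
  | n + 1, X, f => curN n (R.cur ((α_ X (tensorPow A n) A).hom ≫ f))

/-- The set `C(I, A)` of global elements of `A`. -/
structure Elt (_ : ReflexiveObject A) where
  /-- the morphism -/
  hom : 𝟙_ C ⟶ A

/-- The element `cur(g)` of `A` given by an endomorphism `g` of `A ≅ I ⊗ A`. -/
def elt (g : A ⟶ A) : R.Elt := ⟨R.cur ((λ_ A).hom ≫ g)⟩

/-- The combinatory algebra `C(I, A)`: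
`a · b = (a ⊗ b) ; app`, `B = cur³((A ⊗ app) ; app)`, `I = cur(id)`, `a• = cur((A ⊗ a) ; app)`. -/
instance : CombinatorData R.Elt where
  ap a b := ⟨(λ_ (𝟙_ C)).inv ≫ (a.hom ⊗ₘ b.hom) ≫ R.app⟩
  B := R.elt (R.cur (R.cur ((α_ A A A).hom ≫ A ◁ R.app ≫ R.app)))
  I := R.elt (𝟙 A)
  bul a := R.elt ((ρ_ A).inv ≫ A ◁ a.hom ≫ R.app)

/-- The endomorphism `(a ⊗ A) ; app` of `A` given by an element `a`. -/
def act (a : R.Elt) : A ⟶ A := (λ_ A).inv ≫ a.hom ▷ A ≫ R.app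

@[simp] theorem act_elt (g : A ⟶ A) : R.act (R.elt g) = g := by
  simp [act, elt]

@[simp] theorem elt_act (a : R.Elt) : R.elt (R.act a) = a := by
  cases a with | mk a =>
  refine congrArg Elt.mk (R.cur_unique _ _ ?_).symm
  simp [act]

theorem act_injective {a b : R.Elt} (h : R.act a = R.act b) : a = b := by
  rw [← R.elt_act a, h, R.elt_act]

theorem ap_hom (a b : R.Elt) : (a ⬝ b).hom = b.hom ≫ R.act a := by
  change (λ_ (𝟙_ C)).inv ≫ (a.hom ⊗ₘ b.hom) ≫ R.app = _
  simp [act, MonoidalCategory.tensorHom_def']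

theorem elt_ext {a b : R.Elt} (h : a.hom = b.hom) : a = b := by
  cases a; cases b; exact congrArg Elt.mk h

theorem act_B : R.act B = R.cur (R.cur ((α_ A A A).hom ≫ A ◁ R.app ≫ R.app)) := R.act_elt _

theorem act_I : R.act I = 𝟙 A := R.act_elt _

theorem act_bul (a : R.Elt) : R.act (bul a) = (ρ_ A).inv ≫ A ◁ a.hom ≫ R.app := R.act_elt _

theorem act_B_app :
    (R.act B ▷ A ≫ R.app) ▷ A ≫ R.app = (α_ A A A).hom ≫ A ◁ R.app ≫ R.app := by
  rw [act_B]; simp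

theorem act_ap_app (a b : R.Elt) :
    R.act (a ⬝ b) = (λ_ A).inv ≫ b.hom ▷ A ≫ R.act a ▷ A ≫ R.app := by
  rw [act, ap_hom]; simp

theorem act_B_ap (a : R.Elt) : R.act (B ⬝ a) ▷ A ≫ R.app = R.app ≫ R.act a := by
  rw [act_ap_app]
  have h := R.act_B_app
  have e : (((λ_ A).inv ≫ a.hom ▷ A) ▷ A) ≫ (R.act B ▷ A ≫ R.app) ▷ A ≫ R.app =
    R.app ≫ R.act a := by
    rw [h, act, comp_whiskerRight, Category.assoc, associator_naturality_left_assoc,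
      ← whisker_exchange_assoc]
    simp
  rw [← e]; simp

theorem act_mul (a b : R.Elt) : R.act (a * b) = R.act b ≫ R.act a := by
  change R.act (B ⬝ a ⬝ b) = _
  rw [act_ap_app, act_B_ap]; simp [act]

theorem act_one : R.act 1 = 𝟙 A := R.act_I

theorem act_B_bul (a : R.Elt) :
    (R.act B ≫ R.act (bul a)) ▷ A ≫ R.app = A ◁ R.act a ≫ R.app := by
  have h := R.act_B_app
  have e : ((ρ_ A).inv ≫ A ◁ a.hom) ▷ A ≫ (R.act B ▷ A ≫ R.app) ▷ A ≫ R.app =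
    A ◁ R.act a ≫ R.app := by
    rw [h, act]; simp
  rw [← e, act_bul]
  simp only [← comp_whiskerRight_assoc, Category.assoc, whisker_exchange_assoc,
    rightUnitor_inv_naturality_assoc]

/-- `p : A ⊗ P ⟶ A` behaves as the `n`-fold application. -/
structure IsAct (n : ℕ) {P : C} (p : A ⊗ P ⟶ A) : Prop where
  inj : ∀ {X : C} {g h : X ⟶ A}, g ▷ P ≫ p = h ▷ P ≫ p → g = h
  pow : (R.act (Bpow n) ▷ A ≫ R.app) ▷ P ≫ p = (α_ A A P).hom ≫ A ◁ p ≫ R.app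

theorem isAct_zero : R.IsAct 0 (ρ_ A).hom where
  inj h := by simpa using h
  pow := by
    rw [show Bpow 0 = (I : R.Elt) from rfl, act_I]; simp

theorem act_Bpow_comm (n : ℕ) :
    R.act (Bpow n) ≫ R.act B = R.act B ≫ R.act (Bpow n) := by
  induction n with
  | zero => rw [show Bpow 0 = (I : R.Elt) from rfl, act_I]; simp
  | succ n ih => rw [show Bpow (n + 1) = (B * Bpow n : R.Elt) from rfl, act_mul,
      Category.assoc, ← Category.assoc (R.act B), ← ih, Category.assoc]

variable {R} in
theorem IsAct.succ {n : ℕ} {P : C} {p : A ⊗ P ⟶ A} (hp : R.IsAct n p) :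
    R.IsAct (n + 1) ((α_ A P A).inv ≫ p ▷ A ≫ R.app) where
  inj {X g h} e := by
    refine hp.inj (R.ext_app ?_)
    have := congrArg (fun x => (α_ X P A).hom ≫ x) e
    simpa using this
  pow := by
    have e1 : R.act (Bpow (n + 1)) = R.act B ≫ R.act (Bpow n) := by
      rw [← R.act_Bpow_comm, ← R.act_mul]; rfl
    have e2 : (R.act (Bpow (n + 1)) ▷ A ≫ R.app) ▷ P ≫ p =
        (α_ A A P).hom ≫ A ◁ p ≫ R.act B ▷ A ≫ R.app := by
      have h := congrArg (fun x => (R.act B ▷ A ▷ P) ≫ x) hp.pow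
      rw [e1]
      simp only [comp_whiskerRight, Category.assoc] at h ⊢
      rw [h, associator_naturality_left_assoc, ← whisker_exchange_assoc]
    calc _ = (α_ (A ⊗ A) P A).inv ≫
          ((R.act (Bpow (n + 1)) ▷ A ≫ R.app) ▷ P ≫ p) ▷ A ≫ R.app := by simp
      _ = (α_ (A ⊗ A) P A).inv ≫ (α_ A A P).hom ▷ A ≫ (A ◁ p) ▷ A ≫
          (R.act B ▷ A ≫ R.app) ▷ A ≫ R.app := by rw [e2]; simp
      _ = _ := by rw [R.act_B_app]; simp

theorem isAct_appN (n : ℕ) : R.IsAct n (R.appN n) := by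
  induction n with
  | zero => exact R.isAct_zero
  | succ n ih => exact ih.succ

theorem isAct_app : R.IsAct 1 R.app where
  inj := R.ext_app
  pow := by
    rw [show Bpow 1 = (B * I : R.Elt) from rfl, act_mul, act_I, Category.id_comp, act_B_app]

/-- `(A ⊗ A) ⊗ A`-ary application. -/
def app₂ : A ⊗ (A ⊗ A) ⟶ A := (α_ A A A).inv ≫ R.app ▷ A ≫ R.app

theorem isAct_app₂ : R.IsAct 2 R.app₂ := R.isAct_app.succ

/-- Abstraction over `P` of `f : P ⟶ Q` is the endomorphism `e` of `A`. -/
def Rep {P Q : C} (p : A ⊗ P ⟶ A) (q : A ⊗ Q ⟶ A) (e : A ⟶ A) (f : P ⟶ Q) : Prop :=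
  e ▷ P ≫ p = A ◁ f ≫ q

section

variable {R}

theorem Rep.comp {P Q S : C} {p : A ⊗ P ⟶ A} {q : A ⊗ Q ⟶ A} {s : A ⊗ S ⟶ A} {e e' : A ⟶ A}
    {f : P ⟶ Q} {g : Q ⟶ S} (h : Rep p q e f) (h' : Rep q s e' g) :
    Rep p s (e' ≫ e) (f ≫ g) := by
  unfold Rep at *
  rw [comp_whiskerRight, Category.assoc, h, ← whisker_exchange_assoc, h']
  simp

theorem Rep.one {P : C} {p : A ⊗ P ⟶ A} : Rep p p (𝟙 A) (𝟙 P) := by simp [Rep]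

theorem IsAct.rep_unique {n : ℕ} {P Q : C} {p : A ⊗ P ⟶ A} {q : A ⊗ Q ⟶ A} {e e' : A ⟶ A}
    {f : P ⟶ Q} (hp : R.IsAct n p) (h : Rep p q e f) (h' : Rep p q e' f) : e = e' :=
  hp.inj (h.trans h'.symm)

theorem Rep.whiskerRight {P Q : C} {p : A ⊗ P ⟶ A} {q : A ⊗ Q ⟶ A} {e : A ⟶ A}
    {f : P ⟶ Q} (h : Rep p q e f) :
    Rep ((α_ A P A).inv ≫ p ▷ A ≫ R.app) ((α_ A Q A).inv ≫ q ▷ A ≫ R.app) e (f ▷ A) := by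
  unfold Rep at *
  have := congrArg (fun x => (α_ A P A).inv ≫ x ▷ A ≫ R.app) h
  simpa using this

theorem Rep.whiskerLeft {P Q : C} {p : A ⊗ P ⟶ A} {q : A ⊗ Q ⟶ A} {a : R.Elt}
    {f : P ⟶ Q} (h : Rep p q (R.act a) f) :
    Rep ((α_ A A P).inv ≫ R.app ▷ P ≫ p) ((α_ A A Q).inv ≫ R.app ▷ Q ≫ q)
      (R.act (B ⬝ a)) (A ◁ f) := by
  unfold Rep at *
  calc _ = (α_ A A P).inv ≫ (R.act (B ⬝ a) ▷ A ≫ R.app) ▷ P ≫ p := by simp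
    _ = (α_ A A P).inv ≫ R.app ▷ P ≫ (R.act a ▷ P ≫ p) := by rw [act_B_ap]; simp
    _ = _ := by rw [h, ← whisker_exchange_assoc]; simp

theorem Rep.arity {m n : ℕ} {P Q : C} {p : A ⊗ P ⟶ A} {q : A ⊗ Q ⟶ A} {a : R.Elt}
    {f : P ⟶ Q} (hp : R.IsAct m p) (hq : R.IsAct n q) (h : Rep p q (R.act a) f) :
    HasArity m n a := by
  refine R.act_injective (R.ext_app (hp.inj ?_))
  have e1 : R.act (bul a * Bpow (m + 1)) = R.act (Bpow m) ≫ R.act B ≫ R.act (bul a) := by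
    rw [act_mul, show Bpow (m + 1) = (B * Bpow m : R.Elt) from rfl, act_mul, Category.assoc]
  have e2 : R.act (bul a * Bpow (m + 1)) ▷ A ≫ R.app =
      A ◁ R.act a ≫ R.act (Bpow m) ▷ A ≫ R.app := by
    rw [e1, comp_whiskerRight, Category.assoc, act_B_bul, whisker_exchange_assoc]
  have e3 : R.act ((B ⬝ a) * Bpow n) ▷ A ≫ R.app =
      (R.act (Bpow n) ▷ A ≫ R.app) ≫ R.act a := by
    rw [act_mul, comp_whiskerRight, Category.assoc, act_B_ap, Category.assoc]
  unfold Rep at h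
  rw [e2, e3]
  calc _ = (A ◁ R.act a) ▷ P ≫ (R.act (Bpow m) ▷ A ≫ R.app) ▷ P ≫ p := by simp
    _ = (α_ A A P).hom ≫ A ◁ (R.act a ▷ P ≫ p) ≫ R.app := by rw [hp.pow]; simp
    _ = (A ⊗ A) ◁ f ≫ (R.act (Bpow n) ▷ A ≫ R.app) ▷ Q ≫ q := by rw [h, hq.pow]; simp
    _ = (R.act (Bpow n) ▷ A ≫ R.app) ▷ P ≫ A ◁ f ≫ q := by rw [whisker_exchange_assoc]
    _ = _ := by rw [← h]; simp

theorem rep_B : Rep R.app₂ R.app (R.act B) R.app := by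
  have h := R.act_B_app
  unfold Rep app₂
  calc _ = (α_ A A A).inv ≫ (R.act B ▷ A ≫ R.app) ▷ A ≫ R.app := by simp
    _ = _ := by rw [h]; simp

theorem rep_bul (a : R.Elt) : Rep (ρ_ A).hom R.app (R.act (bul a)) a.hom := by
  unfold Rep
  rw [rightUnitor_naturality, act_bul]
  simp

end

theorem mul_I (a : R.Elt) : a * (I : R.Elt) = a :=
  R.act_injective (by rw [act_mul, act_I, Category.id_comp])

instance : ExtBIAlgebra R.Elt where
  B_ap a b c := R.elt_ext (by
    change ((a * b) ⬝ c).hom = _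
    rw [ap_hom, ap_hom, ap_hom, act_mul, Category.assoc])
  I_ap a := R.elt_ext (by rw [ap_hom, act_I, Category.comp_id])
  bul_ap a b := R.elt_ext (by
    rw [ap_hom, ap_hom, act_bul, act, rightUnitor_inv_naturality_assoc,
      leftUnitor_inv_naturality_assoc, ← whisker_exchange_assoc, unitors_inv_equal])
  B_I := R.act_injective (R.ext_app (by rw [act_B_ap, act_I]; simp))
  bul_app a b := R.act_injective (by
    have h := R.act_B_bul a
    rw [act_mul, act_mul, R.act_bul b, R.act_bul (a ⬝ b), ap_hom]
    rw [rightUnitor_inv_naturality_assoc, ← whisker_exchange_assoc, h]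
    simp)
  arity_B := by
    have h : bul B * (B * (B * (B * I))) = (B ⬝ B) * (B * I : R.Elt) :=
      Rep.arity R.isAct_app₂ R.isAct_app rep_B
    simpa only [mul_I] using h
  arity_I := by
    have h : bul I * (B * I) = (B ⬝ I) * (I : R.Elt) :=
      Rep.arity R.isAct_zero R.isAct_zero (f := 𝟙 _) (by rw [act_I]; exact Rep.one)
    simpa only [mul_I] using h
  arity_bul a := by
    have h : bul (bul a) * (B * I) = (B ⬝ bul a) * (B * I : R.Elt) :=
      Rep.arity R.isAct_zero R.isAct_app (rep_bul a)
    simpa only [mul_I] using h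

/-- The twofold abstraction of a morphism `A ⊗ A ⟶ A ⊗ A`. -/
def abs₂ (f : A ⊗ A ⟶ A ⊗ A) : R.Elt := R.elt (R.cur (R.cur ((α_ A A A).hom ≫ A ◁ f ≫ R.app₂)))

/-- The abstraction of a morphism `A ⟶ A`. -/
def abs₁ (f : A ⟶ A) : R.Elt := R.elt (R.cur (A ◁ f ≫ R.app))

section

variable {R}

theorem rep_abs₂ (f : A ⊗ A ⟶ A ⊗ A) : Rep R.app₂ R.app₂ (R.act (R.abs₂ f)) f := by
  unfold Rep abs₂
  rw [act_elt]
  have h := R.cur_app ((α_ A A A).hom ≫ A ◁ f ≫ R.app₂)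
  have h' := R.cur_app (R.cur ((α_ A A A).hom ≫ A ◁ f ≫ R.app₂))
  generalize R.cur (R.cur ((α_ A A A).hom ≫ A ◁ f ≫ R.app₂)) = g at *
  rw [← h', comp_whiskerRight, Category.assoc] at h
  rw [app₂] at h ⊢
  have e := congrArg (fun x => (α_ A A A).inv ≫ x) h
  simpa using e

theorem rep_abs₁ (f : A ⟶ A) : Rep R.app R.app (R.act (R.abs₁ f)) f := by
  unfold Rep abs₁
  rw [act_elt, cur_app]

theorem rep_one_assoc {P Q S : C} (p : A ⊗ P ⟶ A) (q : A ⊗ Q ⟶ A) (s : A ⊗ S ⟶ A) :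
    Rep ((α_ A (P ⊗ Q) S).inv ≫ ((α_ A P Q).inv ≫ p ▷ Q ≫ q) ▷ S ≫ s)
      ((α_ A P (Q ⊗ S)).inv ≫ p ▷ (Q ⊗ S) ≫ (α_ A Q S).inv ≫ q ▷ S ≫ s)
      (𝟙 A) (α_ P Q S).hom := by
  simp [Rep]

theorem rep_one_assoc_inv {P Q S : C} (p : A ⊗ P ⟶ A) (q : A ⊗ Q ⟶ A) (s : A ⊗ S ⟶ A) :
    Rep ((α_ A P (Q ⊗ S)).inv ≫ p ▷ (Q ⊗ S) ≫ (α_ A Q S).inv ≫ q ▷ S ≫ s)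
      ((α_ A (P ⊗ Q) S).inv ≫ ((α_ A P Q).inv ≫ p ▷ Q ≫ q) ▷ S ≫ s)
      (𝟙 A) (α_ P Q S).inv := by
  simp [Rep]

theorem isBraidPair_abs₂ {s t : A ⊗ A ⟶ A ⊗ A} (st : s ≫ t = 𝟙 _) (ts : t ≫ s = 𝟙 _)
    (B_s : A ◁ R.app ≫ s = (α_ A A A).inv ≫ s ▷ A ≫ (α_ A A A).hom ≫ A ◁ s ≫
      (α_ A A A).inv ≫ R.app ▷ A)
    (B_t : A ◁ R.app ≫ t = (α_ A A A).inv ≫ t ▷ A ≫ (α_ A A A).hom ≫ A ◁ t ≫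
      (α_ A A A).inv ≫ R.app ▷ A)
    (bul_s : ∀ a : 𝟙_ C ⟶ A, A ◁ a ≫ s = (ρ_ A).hom ≫ (λ_ A).inv ≫ a ▷ A)
    (bul_t : ∀ a : 𝟙_ C ⟶ A, A ◁ a ≫ t = (ρ_ A).hom ≫ (λ_ A).inv ≫ a ▷ A) :
    BalancedExtBIAlgebra.IsBraidPair (R.abs₂ s) (R.abs₂ t) := by
  have inv : ∀ {s t : A ⊗ A ⟶ A ⊗ A}, s ≫ t = 𝟙 _ → R.abs₂ s * R.abs₂ t = 1 := by
    intro s t st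
    refine R.act_injective ?_
    rw [act_mul, act_one]
    refine R.isAct_app₂.rep_unique ((rep_abs₂ s).comp (rep_abs₂ t)) ?_
    rw [st]; exact Rep.one
  have hB : ∀ {s : A ⊗ A ⟶ A ⊗ A}, A ◁ R.app ≫ s = (α_ A A A).inv ≫ s ▷ A ≫ (α_ A A A).hom ≫
      A ◁ s ≫ (α_ A A A).inv ≫ R.app ▷ A →
      (B ⬝ B) * R.abs₂ s = R.abs₂ s * ((B ⬝ R.abs₂ s) * B) := by
    intro s e
    refine R.act_injective ?_
    have h0 := rep_one_assoc R.app R.app R.app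
    have h0' := rep_one_assoc_inv R.app R.app R.app
    have h1 := ((rep_B (R := R)).whiskerLeft).comp (rep_abs₂ s)
    have h2 := (h0'.comp ((rep_abs₂ s).whiskerRight.comp (h0.comp
      ((rep_abs₂ s).whiskerLeft.comp (h0'.comp (rep_B (R := R)).whiskerRight)))))
    rw [← e] at h2
    have h3 := R.isAct_app₂.succ.rep_unique (h0.comp h1) (h0.comp h2)
    simpa [act_mul] using h3
  have hbul : ∀ {s : A ⊗ A ⟶ A ⊗ A}, (∀ a : 𝟙_ C ⟶ A, A ◁ a ≫ s =
      (ρ_ A).hom ≫ (λ_ A).inv ≫ a ▷ A) → ∀ a : R.Elt, (B ⬝ bul a) * R.abs₂ s = bul a := by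
    intro s e a
    refine R.act_injective ?_
    have h1 := ((rep_bul a).whiskerLeft).comp (rep_abs₂ s)
    have h2 := (rep_bul a).whiskerRight (R := R)
    rw [e a.hom] at h1
    have h3 : Rep ((α_ A (𝟙_ C) A).inv ≫ (ρ_ A).hom ▷ A ≫ R.app)
        ((α_ A A (𝟙_ C)).inv ≫ R.app ▷ 𝟙_ C ≫ (ρ_ A).hom)
        (𝟙 A) ((λ_ A).hom ≫ (ρ_ A).inv) := by
      simp [Rep]
    have h4 := h3.comp h1
    simp only [Category.assoc, Iso.inv_hom_id_assoc, Iso.hom_inv_id_assoc] at h4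
    have h5 := R.isAct_zero.succ.rep_unique h4 h2
    simpa [act_mul] using h5
  exact
    { arity_c := Rep.arity R.isAct_app₂ R.isAct_app₂ (rep_abs₂ s)
      arity_d := Rep.arity R.isAct_app₂ R.isAct_app₂ (rep_abs₂ t)
      cd := inv st
      dc := inv ts
      B_c := hB B_s
      B_d := hB B_t
      bul_c := hbul bul_s
      bul_d := hbul bul_t }

theorem isTwistPair_abs {s t : A ⊗ A ⟶ A ⊗ A} {u v : A ⟶ A}
    (hst : BalancedExtBIAlgebra.IsBraidPair (R.abs₂ s) (R.abs₂ t))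
    (uv : u ≫ v = 𝟙 _) (vu : v ≫ u = 𝟙 _)
    (app_u : R.app ≫ u = u ▷ A ≫ s ≫ u ▷ A ≫ s ≫ R.app)
    (app_v : R.app ≫ v = v ▷ A ≫ t ≫ v ▷ A ≫ t ≫ R.app)
    (bul_u : ∀ a : 𝟙_ C ⟶ A, a ≫ u = a) (bul_v : ∀ a : 𝟙_ C ⟶ A, a ≫ v = a) :
    BalancedExtBIAlgebra.IsTwistPair (R.abs₂ s) (R.abs₂ t) (R.abs₁ u) (R.abs₁ v) := by
  have inv : ∀ {u v : A ⟶ A}, u ≫ v = 𝟙 _ → R.abs₁ u * R.abs₁ v = 1 := by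
    intro u v uv
    refine R.act_injective ?_
    rw [act_mul, act_one]
    refine R.isAct_app.rep_unique ((rep_abs₁ u).comp (rep_abs₁ v)) ?_
    rw [uv]; exact Rep.one
  have hbul : ∀ {u : A ⟶ A}, (∀ a : 𝟙_ C ⟶ A, a ≫ u = a) →
      ∀ a : R.Elt, bul a * R.abs₁ u = bul a := by
    intro u e a
    refine R.act_injective ?_
    have h := (rep_bul a).comp (rep_abs₁ u)
    rw [e] at h
    rw [act_mul]
    exact R.isAct_zero.rep_unique h (rep_bul a)
  have hB : ∀ {s : A ⊗ A ⟶ A ⊗ A} {u : A ⟶ A}, R.app ≫ u = u ▷ A ≫ s ≫ u ▷ A ≫ s ≫ R.app →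
      B * R.abs₁ u = R.abs₁ u * R.abs₂ s * R.abs₁ u * R.abs₂ s * B := by
    intro s u e
    refine R.act_injective ?_
    have h1 := (rep_B (R := R)).comp (rep_abs₁ u)
    have h2 := ((rep_abs₁ u).whiskerRight (R := R)).comp ((rep_abs₂ s).comp
      (((rep_abs₁ u).whiskerRight (R := R)).comp ((rep_abs₂ s).comp (rep_B (R := R)))))
    rw [← e] at h2
    have h3 := R.isAct_app₂.rep_unique h1 h2
    simpa [act_mul] using h3
  exact
    { toIsBraidPair := hst
      arity_t := Rep.arity R.isAct_app R.isAct_app (rep_abs₁ u)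
      arity_s := Rep.arity R.isAct_app R.isAct_app (rep_abs₁ v)
      ts := inv uv
      st := inv vu
      bul_t := hbul bul_u
      bul_s := hbul bul_v
      B_t := hB app_u
      B_s := hB app_v }

end

end ReflexiveObject

section

variable [BraidedCategory C]

theorem app_braid {A : C} (f : A ⊗ A ⟶ A) : A ◁ f ≫ (β_ A A).hom =
    (α_ A A A).inv ≫ (β_ A A).hom ▷ A ≫ (α_ A A A).hom ≫ A ◁ (β_ A A).hom ≫
      (α_ A A A).inv ≫ f ▷ A := by
  rw [BraidedCategory.braiding_naturality_right]
  have h := BraidedCategory.braiding_tensor_right_hom A A A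
  rw [h]; simp

theorem app_braid_inv {A : C} (f : A ⊗ A ⟶ A) : A ◁ f ≫ (β_ A A).inv =
    (α_ A A A).inv ≫ (β_ A A).inv ▷ A ≫ (α_ A A A).hom ≫ A ◁ (β_ A A).inv ≫
      (α_ A A A).inv ≫ f ▷ A := by
  rw [BraidedCategory.braiding_inv_naturality_right]
  have h := BraidedCategory.braiding_tensor_left_inv A A A
  rw [h]; simp

theorem point_braid {A : C} (a : 𝟙_ C ⟶ A) :
    A ◁ a ≫ (β_ A A).hom = (ρ_ A).hom ≫ (λ_ A).inv ≫ a ▷ A := by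
  rw [BraidedCategory.braiding_naturality_right]
  simp [braiding_tensorUnit_right]

theorem point_braid_inv {A : C} (a : 𝟙_ C ⟶ A) :
    A ◁ a ≫ (β_ A A).inv = (ρ_ A).hom ≫ (λ_ A).inv ≫ a ▷ A := by
  rw [BraidedCategory.braiding_inv_naturality_right]
  simp [braiding_inv_tensorUnit_left]

variable [BalancedCategory C]

open BalancedCategory

theorem twist_unit : (twist (𝟙_ C)).hom = 𝟙 (𝟙_ C) := by
  have h := twist_tensor (𝟙_ C) (𝟙_ C)
  have h' := twist_naturality (λ_ (𝟙_ C)).hom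
  rw [h] at h'
  have e : (λ_ (𝟙_ C)).hom ≫ (twist (𝟙_ C)).hom =
      (λ_ (𝟙_ C)).hom ≫ (twist (𝟙_ C)).hom ≫ (twist (𝟙_ C)).hom := by
    rw [h']
    simp [braiding_tensorUnit_right, unitors_equal, unitors_inv_equal, tensorHom_def']
  have e' : (twist (𝟙_ C)).hom = (twist (𝟙_ C)).hom ≫ (twist (𝟙_ C)).hom := by simpa using e
  rw [← cancel_epi (twist (𝟙_ C)).hom, ← e', Category.comp_id]

namespace ReflexiveObject

variable {A : C} (R : ReflexiveObject A)

theorem isTwistPair : BalancedExtBIAlgebra.IsTwistPair (R.abs₂ (β_ A A).hom)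
    (R.abs₂ (β_ A A).inv) (R.abs₁ (twist A).hom) (R.abs₁ (twist A).inv) := by
  have h : R.app ≫ (twist A).hom = (twist A).hom ▷ A ≫ (β_ A A).hom ≫ (twist A).hom ▷ A ≫
      (β_ A A).hom ≫ R.app := by
    rw [twist_naturality, twist_tensor, MonoidalCategory.tensorHom_def',
      BraidedCategory.braiding_naturality_left_assoc]
    simp
  have hp : ∀ a : 𝟙_ C ⟶ A, a ≫ (twist A).hom = a := fun a => by
    rw [twist_naturality, twist_unit, Category.id_comp]
  refine isTwistPair_abs (isBraidPair_abs₂ (by simp) (by simp) (app_braid _) (app_braid_inv _)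
    point_braid point_braid_inv) (by simp) (by simp) h ?_ hp ?_
  · rw [Iso.comp_inv_eq]
    simp only [Category.assoc]
    rw [h]
    have e1 : (β_ A A).inv ≫ (twist A).hom ▷ A = A ◁ (twist A).hom ≫ (β_ A A).inv := by
      rw [← BraidedCategory.braiding_inv_naturality_right]
    have e3 : (β_ A A).inv ≫ A ◁ (twist A).hom = (twist A).hom ▷ A ≫ (β_ A A).inv := by
      rw [← BraidedCategory.braiding_inv_naturality_left]
    have e2 : (β_ A A).inv ≫ (twist A).inv ▷ A = A ◁ (twist A).inv ≫ (β_ A A).inv := by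
      rw [← BraidedCategory.braiding_inv_naturality_right]
    rw [reassoc_of% e2, reassoc_of% e1, ← whisker_exchange_assoc, reassoc_of% e3,
      Iso.inv_hom_id_assoc, reassoc_of% e1]
    simp
  · intro a
    rw [Iso.comp_inv_eq, hp]

/-- The balanced algebra `C(I, A)`:
`C^± = cur³((A ⊗ σ^±) ; (app ⊗ A) ; app)`, `θ^± = cur²((A ⊗ θ^±) ; app)`. -/
instance : BalancedExtBIAlgebra R.Elt where
  Cp := R.abs₂ (β_ A A).hom
  Cm := R.abs₂ (β_ A A).inv
  θp := R.abs₁ (twist A).hom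
  θm := R.abs₁ (twist A).inv
  arity_Cp := R.isTwistPair.arity_c
  arity_Cm := R.isTwistPair.arity_d
  Cp_Cm := R.isTwistPair.cd
  Cm_Cp := R.isTwistPair.dc
  yang_baxter_Cp := R.isTwistPair.toIsBraidPair.yang_baxter
  yang_baxter_Cm := R.isTwistPair.toIsBraidPair.symm.yang_baxter
  B_Cp := R.isTwistPair.B_c
  B_Cm := R.isTwistPair.B_d
  bul_Cp := R.isTwistPair.bul_c
  bul_Cm := R.isTwistPair.bul_d
  arity_θp := R.isTwistPair.arity_t
  arity_θm := R.isTwistPair.arity_s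
  θp_θm := R.isTwistPair.ts
  θm_θp := R.isTwistPair.st
  bul_θp := R.isTwistPair.bul_t
  bul_θm := R.isTwistPair.bul_s
  B_θp := R.isTwistPair.B_t
  B_θm := R.isTwistPair.B_s

end ReflexiveObject

end
end Reflexive

section Ribbon

variable {C : Type*} [Category C] [MonoidalCategory C] [BraidedCategory C] [RightRigidCategory C]
  [BalancedCategory C]

open BalancedCategory

variable (C) in
/-- Ribbon categories: balanced monoidal categories with duals such that `θ_X* = θ_{X*}`.
The dual `X* = Xᘁ` has unit `η : I ⟶ X ⊗ X*` and counit `ε : X* ⊗ X ⟶ I`. -/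
class RibbonCategory : Prop where
  twist_dual : ∀ X : C, ((twist X).hom)ᘁ = (twist (Xᘁ)).hom

/-- The trace `Tr^X_{P,Q}(f) : P ⟶ Q` of `f : P ⊗ X ⟶ Q ⊗ X`. -/
def trace {P Q : C} (X : C) (f : P ⊗ X ⟶ Q ⊗ X) : P ⟶ Q :=
  (ρ_ P).inv ≫ P ◁ η_ X Xᘁ ≫ (α_ P X Xᘁ).inv ≫ f ▷ Xᘁ ≫ (α_ Q X Xᘁ).hom ≫
    Q ◁ ((β_ X Xᘁ).hom ≫ Xᘁ ◁ (twist X).hom ≫ ε_ X Xᘁ) ≫ (ρ_ Q).hom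

/-- The trivial loop `○ = Tr^X(id_X) : I ⟶ I`. -/
def loop (X : C) : 𝟙_ C ⟶ 𝟙_ C := trace X (𝟙 (𝟙_ C ⊗ X))

namespace ReflexiveObject

variable {A : C} (R : ReflexiveObject A)

/-- `φ = cur(A ⊗ ε) : A ⊗ A* ⟶ A` -/
def lamArrow : A ⊗ Aᘁ ⟶ A :=
  R.cur ((α_ A Aᘁ A).hom ≫ A ◁ ε_ A Aᘁ ≫ (ρ_ A).hom)

/-- `lam : A ⟶ A ⊗ A`, the composite of `A ⊗ η'`, where `η' = η ; (A ⊗ θ⁻¹) ; σ⁻¹ : I ⟶ A* ⊗ A`,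
and `φ ⊗ A`. -/
def lam : A ⟶ A ⊗ A :=
  (ρ_ A).inv ≫ A ◁ (η_ A Aᘁ ≫ A ◁ (twist (Aᘁ)).inv ≫ (β_ (Aᘁ) A).inv) ≫
    (α_ A Aᘁ A).inv ≫ R.lamArrow ▷ A

/-- `lam_n : A ⟶ A ⊗ A^{⊗ n}`, with `lam_0 = id` and `lam_{n+1} = lam ; (lam_n ⊗ A)`. -/
def lamN : ∀ n : ℕ, A ⟶ A ⊗ tensorPow A n
  | 0 => (ρ_ A).inv
  | n + 1 => R.lam ≫ lamN n ▷ A ≫ (α_ A (tensorPow A n) A).hom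

end ReflexiveObject

end Ribbon

/-- The category `C|_A`: the full subcategory of `C` on the tensor powers `A^{⊗ n}`, with the
natural numbers as objects. -/
structure TensorPowers {C : Type*} (A : C) where
  /-- the exponent -/
  len : ℕ

namespace TensorPowers

variable {C : Type*} [Category C] [MonoidalCategory C] {A : C}

/-- Morphisms `m ⟶ n` of `C|_A` are all morphisms `A^{⊗ m} ⟶ A^{⊗ n}` of `C`. -/
@[ext]
structure Hom (X Y : TensorPowers A) where
  /-- the morphism of `C` -/
  hom : tensorPow A X.len ⟶ tensorPow A Y.len

instance : Category (TensorPowers A) where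
  Hom := Hom
  id X := ⟨𝟙 _⟩
  comp f g := ⟨f.hom ≫ g.hom⟩

@[simp] theorem id_hom (X : TensorPowers A) : Hom.hom (𝟙 X) = 𝟙 (tensorPow A X.len) := rfl
@[simp] theorem comp_hom {X Y Z : TensorPowers A} (f : X ⟶ Y) (g : Y ⟶ Z) :
    Hom.hom (f ≫ g) = Hom.hom f ≫ Hom.hom g := rfl

@[ext] theorem hom_ext {X Y : TensorPowers A} {f g : X ⟶ Y} (h : Hom.hom f = Hom.hom g) : f = g :=
  Hom.ext h

/-- The isomorphism `A^{⊗ m} ⊗ A^{⊗ n} ≅ A^{⊗ (m + n)}`. -/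
def powAdd (A : C) (m : ℕ) : ∀ n : ℕ, tensorPow A m ⊗ tensorPow A n ≅ tensorPow A (m + n)
  | 0 => ρ_ (tensorPow A m)
  | n + 1 => (α_ (tensorPow A m) (tensorPow A n) A).symm ≪≫ whiskerRightIso (powAdd A m n) A

/-- Isomorphisms of `C|_A`. -/
def isoMk {X Y : TensorPowers A} (e : tensorPow A X.len ≅ tensorPow A Y.len) : X ≅ Y where
  hom := ⟨e.hom⟩
  inv := ⟨e.inv⟩
  hom_inv_id := by ext; simp
  inv_hom_id := by ext; simp

@[simp] theorem isoMk_hom_hom {X Y : TensorPowers A} (e : tensorPow A X.len ≅ tensorPow A Y.len) :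
    (isoMk (X := X) (Y := Y) e).hom.hom = e.hom := rfl
@[simp] theorem isoMk_inv_hom {X Y : TensorPowers A} (e : tensorPow A X.len ≅ tensorPow A Y.len) :
    (isoMk (X := X) (Y := Y) e).inv.hom = e.inv := rfl

/-- The inclusion of `C|_A` in `C`. -/
def incl (A : C) : TensorPowers A ⥤ C where
  obj X := tensorPow A X.len
  map f := Hom.hom f

instance : (incl A).Faithful where
  map_injective h := hom_ext h

instance : (incl A).Full where
  map_surjective f := ⟨⟨f⟩, rfl⟩

/-- The monoidal structure of `C|_A`: `m ⊗ n = m + n`, and on morphisms the tensor product of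
`C`. -/
instance : MonoidalCategoryStruct (TensorPowers A) where
  tensorObj X Y := ⟨X.len + Y.len⟩
  tensorUnit := ⟨0⟩
  whiskerLeft X Y₁ Y₂ f :=
    ⟨(powAdd A X.len Y₁.len).inv ≫ tensorPow A X.len ◁ Hom.hom f ≫ (powAdd A X.len Y₂.len).hom⟩
  whiskerRight {X₁ X₂} f Y :=
    ⟨(powAdd A X₁.len Y.len).inv ≫ Hom.hom f ▷ tensorPow A Y.len ≫ (powAdd A X₂.len Y.len).hom⟩
  tensorHom {X₁ Y₁ X₂ Y₂} f g :=
    ⟨(powAdd A X₁.len X₂.len).inv ≫ (Hom.hom f ⊗ₘ Hom.hom g) ≫ (powAdd A Y₁.len Y₂.len).hom⟩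
  associator X Y Z := isoMk
    ((powAdd A (X.len + Y.len) Z.len).symm ≪≫
      whiskerRightIso (powAdd A X.len Y.len).symm (tensorPow A Z.len) ≪≫
      α_ (tensorPow A X.len) (tensorPow A Y.len) (tensorPow A Z.len) ≪≫
      whiskerLeftIso (tensorPow A X.len) (powAdd A Y.len Z.len) ≪≫
      powAdd A X.len (Y.len + Z.len))
  leftUnitor X := isoMk ((powAdd A 0 X.len).symm ≪≫ λ_ (tensorPow A X.len))
  rightUnitor X := isoMk ((powAdd A X.len 0).symm ≪≫ ρ_ (tensorPow A X.len))

theorem assoc_aux {X Y Z XY YZ W W' : C} (p : XY ⊗ Z ≅ W) (q : X ⊗ Y ≅ XY) (r : Y ⊗ Z ≅ YZ)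
    (s : X ⊗ YZ ≅ W') :
    (p.symm ≪≫ whiskerRightIso q.symm Z ≪≫ α_ X Y Z ≪≫ whiskerLeftIso X r ≪≫ s).hom =
    ((p.symm ≪≫ (q.symm ⊗ᵢ .refl _)) ≪≫ α_ X Y Z ≪≫ ((.refl _ ⊗ᵢ r) ≪≫ s)).hom := by
  simp

theorem leftUnitor_aux {X Y : C} (p : 𝟙_ C ⊗ X ≅ Y) : (p.symm ≪≫ λ_ X).hom =
    ((p.symm ≪≫ ((Iso.refl (𝟙_ C)).symm ⊗ᵢ .refl _)) ≪≫ λ_ X).hom := by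
  simp

theorem rightUnitor_aux {X Y : C} (p : X ⊗ 𝟙_ C ≅ Y) : (p.symm ≪≫ ρ_ X).hom =
    ((p.symm ≪≫ (.refl _ ⊗ᵢ (Iso.refl (𝟙_ C)).symm)) ≪≫ ρ_ X).hom := by
  simp

/-- The inclusion preserves the monoidal structure. -/
def inclData (A : C) : Monoidal.InducingFunctorData (incl A) where
  μIso X Y := powAdd A X.len Y.len
  εIso := Iso.refl _
  whiskerLeft_eq _ _ _ _ := rfl
  whiskerRight_eq _ _ := rfl
  tensorHom_eq _ _ := rfl
  associator_eq X Y Z := assoc_aux (powAdd A (X.len + Y.len) Z.len) (powAdd A X.len Y.len)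
    (powAdd A Y.len Z.len) (powAdd A X.len (Y.len + Z.len))
  leftUnitor_eq X := leftUnitor_aux (powAdd A 0 X.len)
  rightUnitor_eq X := rightUnitor_aux (powAdd A X.len 0)

instance : MonoidalCategory (TensorPowers A) := Monoidal.induced (incl A) (inclData A)

instance : (incl A).Monoidal := Monoidal.fromInducedMonoidal (incl A) (inclData A)

theorem incl_mu (X Y : TensorPowers A) :
    Functor.LaxMonoidal.μ (incl A) X Y = (powAdd A X.len Y.len).hom := rfl

theorem tensorHom_hom {X₁ Y₁ X₂ Y₂ : TensorPowers A} (f : X₁ ⟶ Y₁) (g : X₂ ⟶ Y₂) :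
    Hom.hom (f ⊗ₘ g) = (powAdd A X₁.len X₂.len).inv ≫ (Hom.hom f ⊗ₘ Hom.hom g) ≫
      (powAdd A Y₁.len Y₂.len).hom := rfl

variable [BraidedCategory C]

instance : BraidedCategory (TensorPowers A) :=
  BraidedCategory.ofFaithful (incl A)
    (fun X Y => isoMk ((powAdd A X.len Y.len).symm ≪≫
      β_ (tensorPow A X.len) (tensorPow A Y.len) ≪≫ powAdd A Y.len X.len))
    (fun X Y => (powAdd A X.len Y.len).hom_inv_id_assoc _)

theorem braiding_hom_hom (X Y : TensorPowers A) : Hom.hom (β_ X Y).hom =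
    (powAdd A X.len Y.len).inv ≫ (β_ (tensorPow A X.len) (tensorPow A Y.len)).hom ≫
      (powAdd A Y.len X.len).hom := rfl

/-- The twist of `C|_A` is that of `C`. -/
instance [BalancedCategory C] : BalancedCategory (TensorPowers A) where
  twist X := isoMk (BalancedCategory.twist (tensorPow A X.len))
  twist_naturality f := by
    ext; exact BalancedCategory.twist_naturality (Hom.hom f)
  twist_tensor X Y := by
    ext
    rw [comp_hom, comp_hom, braiding_hom_hom, braiding_hom_hom, tensorHom_hom]
    simp only [isoMk_hom_hom, Category.assoc, Iso.hom_inv_id_assoc]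
    have h := BalancedCategory.twist_naturality (powAdd A X.len Y.len).hom
    rw [BalancedCategory.twist_tensor] at h
    rw [Iso.eq_inv_comp]
    refine h.trans ?_
    simp

end TensorPowers

namespace ReflexiveObject

variable {C : Type*} [Category C] [MonoidalCategory C] {A : C} (R : ReflexiveObject A)

theorem curN_aux {X P : C} {k : X ⟶ A} {p : A ⊗ P ⟶ A} {g : X ⊗ (P ⊗ A) ⟶ A}
    (h : k ▷ P ≫ p = R.cur ((α_ X P A).hom ≫ g)) :
    k ▷ (P ⊗ A) ≫ (α_ A P A).inv ≫ p ▷ A ≫ R.app = g := by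
  have e : (k ▷ P ≫ p) ▷ A ≫ R.app = (α_ X P A).hom ≫ g := by rw [h, cur_app]
  rw [← Iso.inv_comp_eq] at e
  rw [← e]
  simp

theorem curN_aux₀ {X : C} (g : X ⊗ 𝟙_ C ⟶ A) :
    ((ρ_ X).inv ≫ g) ▷ 𝟙_ C ≫ (ρ_ A).hom = g := by
  simp

theorem curN_app (n : ℕ) {X : C} (g : X ⊗ tensorPow A n ⟶ A) :
    R.curN n g ▷ tensorPow A n ≫ R.appN n = g := by
  induction n with
  | zero => exact curN_aux₀ g
  | succ n ih => exact R.curN_aux (ih _)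

/-- The element `cur(cur^m((A ⊗ f) ; app_n))` of `C(I, A)` given by `f : A^{⊗ m} ⟶ A^{⊗ n}`. -/
def absN {m n : ℕ} (f : tensorPow A m ⟶ tensorPow A n) : R.Elt :=
  R.elt (R.curN m (A ◁ f ≫ R.appN n))

theorem rep_absN {m n : ℕ} (f : tensorPow A m ⟶ tensorPow A n) :
    Rep (R.appN m) (R.appN n) (R.act (R.absN f)) f := by
  rw [Rep, absN, act_elt, curN_app]

theorem arity_absN {m n : ℕ} (f : tensorPow A m ⟶ tensorPow A n) : HasArity m n (R.absN f) :=
  Rep.arity (R.isAct_appN m) (R.isAct_appN n) (R.rep_absN f)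

theorem absN_id (n : ℕ) : R.absN (𝟙 (tensorPow A n)) = 1 :=
  R.act_injective ((R.isAct_appN n).rep_unique (R.rep_absN _) (by rw [act_one]; exact Rep.one))

theorem absN_comp {l m n : ℕ} (f : tensorPow A l ⟶ tensorPow A m)
    (g : tensorPow A m ⟶ tensorPow A n) : R.absN (f ≫ g) = R.absN f * R.absN g :=
  R.act_injective ((R.isAct_appN l).rep_unique (R.rep_absN _)
    (by rw [act_mul]; exact (R.rep_absN f).comp (R.rep_absN g)))

/-- The functor `F` from `C|_A` to the internal PRO of `C(I, A)`: the identity on objects, and on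
morphisms `f : A^{⊗ m} ⟶ A^{⊗ n}` the abstraction `cur(cur^m((A ⊗ f) ; app_n))`. -/
def internalFunctor : TensorPowers A ⥤ InternalPRO R.Elt where
  obj X := ⟨X.len⟩
  map f := InternalPRO.homMk (R.absN (TensorPowers.Hom.hom f)) (R.arity_absN _)
  map_id X := InternalPRO.hom_ext (R.absN_id X.len)
  map_comp f g := InternalPRO.hom_ext (R.absN_comp _ _)

end ReflexiveObject

/-! The universal property of `app` makes `A` isomorphic to `A ⊗ A*`, with inverse `φ = cur(A ⊗ ε)`,
and likewise to `A ⊗ (A^{⊗ n})*` for every `n`. Under these isomorphisms abstraction is the bending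
of wires, and each claim becomes a diagram computation with the pairing `(η, ε)` and the reversed
pairing `η' = η;(X ⊗ θ⁻¹);σ⁻¹`, `ε' = σ;(X* ⊗ θ);ε`. The latter satisfies the snake identities
because the twist of a ribbon category is compatible with duals.

Trace formula. The trace over `A` closes a wire with `η` and `ε'`, while `lam` opens one with `η'`.
Since mates computed with `(η, ε)` and with `(η', ε')` coincide (`mate_eq`), closing `lam;(A ⊗ k)`
yields the name of `k` followed by `φ`, which is the outermost `cur` (`trace_lam_whiskerLeft`), and
a `lam` whose output is consumed by a matching `app` can be removed under the trace
(`trace_lam_app`). Induction on the number of variables gives `trace_lamN`.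

Fullness and faithfulness. The loop equals `η';ε`, so the hypothesis provides `c : I ⟶ A* ⊗ A` with
`c;ε = id`. Plugging `c` and `ε` around `A ⊗ u` recovers any `u : Z ⟶ I`, so `A ⊗ _` is injective on
such morphisms. As `(A ⊗ f);app_n` is `A` tensored with the transpose `A^{⊗ n}* ⊗ A^{⊗ m} ⟶ I` of
`f`, up to an isomorphism, `F` is faithful. For fullness, the arity equation of `a` says that the
map `A ⊗ A^{⊗ m} ⟶ A` given by `a` commutes with composition in its first argument. In terms of `A ⊗
A*` that composition is contraction by `ε`; filling the contracted pair of wires with `c` shows that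
the map has the form `A ⊗ g`, and `g` is the transpose of the required `f` (`exists_rep`).

Structure. Elements representing a given morphism are unique, so `F` is computed by exhibiting
representatives: `f ⊗ k` is represented by `F(f)` and `k ⊗ f` by `B^k` applied to it, coherence
isomorphisms by `1`. The hexagons and the twist axiom then reduce braidings and twists to one
strand, where they are `C⁺` and `θ⁺`. Duals exist because `A ≅ A ⊗ A*` is its own dual; `F` carries
the self-pairings of the tensor powers to the internal PROB. Compatibility of the twist with a dual
does not depend on the choice of dual, so the ribbon axiom is inherited on both sides. -/

/-! ### Duals in balanced categories and the reversed pairing -/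

section BalancedDuals

open BalancedCategory BraidedCategory

variable {C : Type*} [Category C] [MonoidalCategory C]

/-- Every morphism has a mate with respect to given exact pairings. -/
theorem exists_mate {X Y : C} (X' Y' : C) [ExactPairing X X'] [ExactPairing Y Y'] (g : X ⟶ Y) :
    ∃ g' : Y' ⟶ X', η_ X X' ≫ g ▷ X' = η_ Y Y' ≫ Y ◁ g' := by
  obtain ⟨h, hh⟩ := (tensorLeftHomEquiv (𝟙_ C) Y Y' X').surjective (η_ X X' ≫ g ▷ X')
  refine ⟨(ρ_ _).inv ≫ h, ?_⟩
  rw [← hh]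
  simp only [tensorLeftHomEquiv, Equiv.coe_fn_mk]
  monoidal

variable [BraidedCategory C] [BalancedCategory C]

/-- Rotation of a tensor factor from the right end to the left end of an element. -/
def rotate {P Q : C} (u : 𝟙_ C ⟶ P ⊗ Q) : 𝟙_ C ⟶ Q ⊗ P :=
  u ≫ P ◁ (twist Q).inv ≫ (β_ Q P).inv

theorem rotate_whiskerRight {P P' Q : C} (u : 𝟙_ C ⟶ P ⊗ Q) (f : P ⟶ P') :
    rotate (u ≫ f ▷ Q) = rotate u ≫ Q ◁ f := by
  simp only [rotate, Category.assoc]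
  rw [← whisker_exchange_assoc, braiding_inv_naturality_left]

theorem twist_inv_naturality {X Y : C} (f : X ⟶ Y) :
    f ≫ (twist Y).inv = (twist X).inv ≫ f := by
  rw [Iso.comp_inv_eq, Category.assoc, twist_naturality, Iso.inv_hom_id_assoc]

theorem rotate_whiskerLeft {P Q Q' : C} (u : 𝟙_ C ⟶ P ⊗ Q) (f : Q ⟶ Q') :
    rotate (u ≫ P ◁ f) = rotate u ≫ f ▷ P := by
  simp only [rotate, Category.assoc]
  rw [← whiskerLeft_comp_assoc, twist_inv_naturality, whiskerLeft_comp_assoc,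
    braiding_inv_naturality_right]

theorem twist_tensor_inv (X Y : C) : (twist (X ⊗ Y)).inv =
    (β_ Y X).inv ≫ ((twist Y).inv ⊗ₘ (twist X).inv) ≫ (β_ X Y).inv := by
  rw [← cancel_mono (twist (X ⊗ Y)).hom, Iso.inv_hom_id, twist_tensor]
  simp

/-- When `Q₂` and then `Q₁` are rotated separately, they cross each other twice; these crossings are
exactly the inverse double braiding contained in the inverse twist of `Q₁ ⊗ Q₂`. -/
theorem rotate_tensor {P Q₁ Q₂ : C} (u : 𝟙_ C ⟶ P ⊗ (Q₁ ⊗ Q₂)) :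
    rotate u = rotate (rotate (u ≫ (α_ P Q₁ Q₂).inv) ≫ (α_ Q₂ P Q₁).inv) ≫
      (α_ Q₁ Q₂ P).inv := by
  simp only [rotate, Category.assoc]
  congr 1
  have e₁ : P ◁ (twist (Q₁ ⊗ Q₂)).inv ≫ (β_ (Q₁ ⊗ Q₂) P).inv =
      P ◁ (β_ Q₂ Q₁).inv ≫ (β_ (Q₂ ⊗ Q₁) P).inv ≫
        ((twist Q₂).inv ⊗ₘ (twist Q₁).inv) ▷ P ≫ (β_ Q₁ Q₂).inv ▷ P := by
    rw [twist_tensor_inv]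
    simp only [whiskerLeft_comp, Category.assoc, braiding_inv_naturality_right,
      braiding_inv_naturality_right_assoc]
  have e₂ : P ◁ Q₁ ◁ (twist Q₂).inv ≫ P ◁ (β_ Q₂ Q₁).inv =
      P ◁ (β_ Q₂ Q₁).inv ≫ P ◁ (twist Q₂).inv ▷ Q₁ := by
    rw [← whiskerLeft_comp, braiding_inv_naturality_right, whiskerLeft_comp]
  have e₃ : P ◁ (twist Q₂).inv ▷ Q₁ ≫ (α_ P Q₂ Q₁).inv ≫ (β_ Q₂ P).inv ▷ Q₁ =
      (α_ P Q₂ Q₁).inv ≫ (β_ Q₂ P).inv ▷ Q₁ ≫ (twist Q₂).inv ▷ P ▷ Q₁ := by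
    rw [associator_inv_naturality_middle_assoc, ← comp_whiskerRight,
      braiding_inv_naturality_right, comp_whiskerRight]
  have e₄ : Q₂ ◁ P ◁ (twist Q₁).inv ≫ Q₂ ◁ (β_ Q₁ P).inv =
      Q₂ ◁ (β_ Q₁ P).inv ≫ Q₂ ◁ (twist Q₁).inv ▷ P := by
    rw [← whiskerLeft_comp, braiding_inv_naturality_right, whiskerLeft_comp]
  rw [e₁]
  simp only [braiding_tensor_right_inv, braiding_tensor_left_inv, MonoidalCategory.tensorHom_def',
    tensor_whiskerLeft, Category.assoc, Iso.inv_hom_id_assoc, Iso.hom_inv_id, Category.comp_id,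
    comp_whiskerRight, reassoc_of% e₂, whisker_assoc]
  rw [reassoc_of% e₄, reassoc_of% e₃]
  rw [associator_naturality_left_assoc, ← whisker_exchange_assoc, ← whisker_exchange_assoc,
    associator_inv_naturality_left_assoc]

/-- The coevaluation `I ⟶ Y ⊗ X` of the reversed pairing, `η ; (X ⊗ θ⁻¹) ; σ⁻¹`. -/
def revCoev (X Y : C) [ExactPairing X Y] : 𝟙_ C ⟶ Y ⊗ X := rotate (η_ X Y)

/-- The evaluation `X ⊗ Y ⟶ I` of the reversed pairing, `σ ; (Y ⊗ θ) ; ε`. -/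
def revEv (X Y : C) [ExactPairing X Y] : X ⊗ Y ⟶ 𝟙_ C :=
  (β_ X Y).hom ≫ Y ◁ (twist X).hom ≫ ε_ X Y

/-- Rotation is natural in both factors, so it carries the mate relation for `η` to the one for
`η'`. -/
theorem revCoev_mate {X Y X' Y' : C} [ExactPairing X X'] [ExactPairing Y Y'] {g : X ⟶ Y}
    {g' : Y' ⟶ X'} (h : η_ X X' ≫ g ▷ X' = η_ Y Y' ≫ Y ◁ g') :
    revCoev X X' ≫ X' ◁ g = revCoev Y Y' ≫ g' ▷ Y := by
  rw [revCoev, revCoev, ← rotate_whiskerRight, h, rotate_whiskerLeft]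

/-- The reversed cups of a tensor product are nested, `η'` of `X` inside `η'` of `Z`. In the proof
the factors `X'` and `Z'` are rotated one after the other, each time treating the remaining cup as a
morphism that slides along. -/
theorem revCoev_tensor (X Z X' Z' : C) [ExactPairing X X'] [ExactPairing Z Z'] :
    revCoev (X ⊗ Z) (Z' ⊗ X') =
      revCoev Z Z' ≫ Z' ◁ ((λ_ Z).inv ≫ revCoev X X' ▷ Z) ≫ 𝟙 _ ⊗≫ 𝟙 _ := by
  have e₁ : η_ (X ⊗ Z) (Z' ⊗ X') ≫ (α_ (X ⊗ Z) Z' X').inv =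
      η_ X X' ≫ ((ρ_ X).inv ≫ X ◁ η_ Z Z' ≫ (α_ X Z Z').inv) ▷ X' := by
    rw [ExactPairing.tensor_coevaluation]; monoidal
  have e₂ : rotate (η_ X X') ≫ X' ◁ ((ρ_ X).inv ≫ X ◁ η_ Z Z' ≫ (α_ X Z Z').inv) ≫
      (α_ X' (X ⊗ Z) Z').inv =
      η_ Z Z' ≫ ((λ_ Z).inv ≫ revCoev X X' ▷ Z ≫ (α_ X' X Z).hom) ▷ Z' := by
    calc _ = 𝟙 _ ⊗≫ (revCoev X X' ▷ 𝟙_ C ≫ (X' ⊗ X) ◁ η_ Z Z') ⊗≫ 𝟙 _ := by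
          rw [revCoev]; monoidal
      _ = 𝟙 _ ⊗≫ (𝟙_ C ◁ η_ Z Z' ≫ revCoev X X' ▷ (Z ⊗ Z')) ⊗≫ 𝟙 _ := by rw [whisker_exchange]
      _ = _ := by monoidal
  rw [revCoev, rotate_tensor, e₁, rotate_whiskerRight, Category.assoc, e₂, rotate_whiskerRight,
    ← revCoev]
  monoidal

/-- The scalar `η' ; ε` is the trivial loop `η ; ε'`. -/
theorem revCoev_evaluation (X Y : C) [ExactPairing X Y] :
    revCoev X Y ≫ ε_ X Y = η_ X Y ≫ revEv X Y := by
  -- The twist of the unit is trivial, so naturality allows the twist of `Y ⊗ X` to be inserted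
  -- before `ε`. Its first braiding and its twist on `Y` cancel those of `η'`, and what is left is
  -- `ε'`.
  have h : ε_ X Y = (twist (Y ⊗ X)).hom ≫ ε_ X Y := by
    rw [← twist_naturality, twist_unit, Category.comp_id]
  rw [revCoev, rotate, h, twist_tensor, revEv]
  simp only [Category.assoc, Iso.inv_hom_id_assoc]
  rw [MonoidalCategory.tensorHom_def']
  simp only [Category.assoc, whiskerLeft_inv_hom_assoc]
  rw [braiding_naturality_left_assoc]

/-- The twists of two paired objects agree along the pairing. -/
def TwistCompatible (X Y : C) [ExactPairing X Y] : Prop :=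
  η_ X Y ≫ (twist X).hom ▷ Y = η_ X Y ≫ X ◁ (twist Y).hom

section

variable {X Y : C} [ExactPairing X Y]

/-- The pairing of `Y` and `X` with coevaluation `η'` and evaluation `ε'`. -/
abbrev revPairing (X Y : C) [ExactPairing X Y] : ExactPairing Y X :=
  letI := exactPairing_swap X Y
  exactPairingCongrRight (twist X)

theorem revPairing_evaluation :
    @ExactPairing.evaluation _ _ _ Y X (revPairing X Y) = revEv X Y := by
  change (twist X).hom ▷ Y ≫ (β_ X Y).hom ≫ ε_ X Y = _
  rw [braiding_naturality_left_assoc, revEv]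

/-- The reversed pairing carries its inverse twist on `X`, whereas `η'` carries it on `Y`;
compatibility moves it along `η`. -/
theorem revPairing_coevaluation (h : TwistCompatible X Y) :
    @ExactPairing.coevaluation _ _ _ Y X (revPairing X Y) = revCoev X Y := by
  change (η_ X Y ≫ (β_ Y X).inv) ≫ Y ◁ (twist X).inv = _
  have h' : η_ X Y ≫ X ◁ (twist Y).inv = η_ X Y ≫ (twist X).inv ▷ Y := by
    rw [← cancel_mono (X ◁ (twist Y).hom), Category.assoc, Category.assoc, ← whisker_exchange,
      ← reassoc_of% h]
    simp
  rw [revCoev, rotate, ← Category.assoc, h', Category.assoc, Category.assoc,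
    braiding_inv_naturality_left]

theorem revCoev_revEv (h : TwistCompatible X Y) :
    revCoev X Y ▷ Y ≫ (α_ Y X Y).hom ≫ Y ◁ revEv X Y = (λ_ Y).hom ≫ (ρ_ Y).inv := by
  let := revPairing X Y
  rw [← revPairing_coevaluation h, ← revPairing_evaluation]
  exact ExactPairing.evaluation_coevaluation Y X

theorem revEv_revCoev (h : TwistCompatible X Y) :
    X ◁ revCoev X Y ≫ (α_ X Y X).inv ≫ revEv X Y ▷ X = (ρ_ X).hom ≫ (λ_ X).inv := by
  let := revPairing X Y
  rw [← revPairing_coevaluation h, ← revPairing_evaluation]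
  exact ExactPairing.coevaluation_evaluation Y X

end

/-- This is the ribbon axiom with the mate unfolded along `η`, a form that makes sense for any
pairing, not only the chosen one. -/
theorem twistCompatible [RightRigidCategory C] [RibbonCategory C] (X : C) :
    TwistCompatible X Xᘁ := by
  rw [TwistCompatible, ← RibbonCategory.twist_dual, coevaluation_comp_rightAdjointMate]

end BalancedDuals

/-! ### Mates computed with the reversed pairing -/

section Abstraction

variable {C : Type*} [Category C] [MonoidalCategory C] [BraidedCategory C] [BalancedCategory C]

/-- Bending `g` around the other side with `η'` and `ε'` gives the same mate: insert a snake of `η'`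
and `ε'` on `Y'`, then slide `g'` through `η'`, where it turns into `g`. -/
theorem mate_eq {X Y X' Y' : C} [ExactPairing X X'] [ExactPairing Y Y'] {g : X ⟶ Y}
    {g' : Y' ⟶ X'} (hY : TwistCompatible Y Y') (h : η_ X X' ≫ g ▷ X' = η_ Y Y' ≫ Y ◁ g') :
    g' = 𝟙 _ ⊗≫ revCoev X X' ▷ Y' ⊗≫ X' ◁ (g ▷ Y' ≫ revEv Y Y') ⊗≫ 𝟙 _ := by
  calc g' = 𝟙 _ ⊗≫ (revCoev Y Y' ▷ Y' ≫ (α_ Y' Y Y').hom ≫ Y' ◁ revEv Y Y') ⊗≫ g' := by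
        rw [revCoev_revEv hY]; monoidal
    _ = 𝟙 _ ⊗≫ revCoev Y Y' ▷ Y' ⊗≫ (Y' ◁ revEv Y Y' ≫ g' ▷ 𝟙_ C) ⊗≫ 𝟙 _ := by monoidal
    _ = 𝟙 _ ⊗≫ (revCoev Y Y' ≫ g' ▷ Y) ▷ Y' ⊗≫ X' ◁ revEv Y Y' ⊗≫ 𝟙 _ := by
        rw [whisker_exchange]; monoidal
    _ = _ := by rw [← revCoev_mate h]; monoidal

end Abstraction

/-! ### Abstraction as a trace -/

section Abstraction

variable {C : Type*} [Category C] [MonoidalCategory C]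

namespace ReflexiveObject

variable {A : C} (R : ReflexiveObject A) [RightRigidCategory C]

theorem lamArrow_app : R.lamArrow ▷ A ≫ R.app = (α_ A Aᘁ A).hom ≫ A ◁ ε_ A Aᘁ ≫ (ρ_ A).hom :=
  R.cur_app _

/-- The isomorphism `A ≅ A ⊗ P*` given by a universal morphism `p : A ⊗ P ⟶ A`. -/
def actIso {P P' : C} [ExactPairing P P'] (p : A ⊗ P ⟶ A) (φ : A ⊗ P' ⟶ A)
    (inj : ∀ {X : C} {g h : X ⟶ A}, g ▷ P ≫ p = h ▷ P ≫ p → g = h)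
    (hφ : φ ▷ P ≫ p = (α_ A P' P).hom ≫ A ◁ ε_ P P' ≫ (ρ_ A).hom) : A ≅ A ⊗ P' where
  hom := (ρ_ A).inv ≫ A ◁ η_ P P' ≫ (α_ A P P').inv ≫ p ▷ P'
  inv := φ
  hom_inv_id := by
    -- A morphism into `A` is determined by its application to `P`; after application `φ` becomes
    -- `ε`, and a snake identity finishes.
    refine inj ?_
    rw [comp_whiskerRight, Category.assoc, hφ]
    calc _ = 𝟙 _ ⊗≫ A ◁ (η_ P P' ▷ P) ⊗≫ (p ▷ (P' ⊗ P) ≫ A ◁ ε_ P P') ⊗≫ 𝟙 _ := by monoidal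
      _ = 𝟙 _ ⊗≫ A ◁ (η_ P P' ▷ P ≫ (α_ P P' P).hom ≫ P ◁ ε_ P P') ⊗≫ p ⊗≫ 𝟙 _ := by
          rw [← whisker_exchange]; monoidal
      _ = _ := by rw [ExactPairing.evaluation_coevaluation]; monoidal
  inv_hom_id := by
    calc _ = 𝟙 _ ⊗≫ (φ ▷ 𝟙_ C ≫ A ◁ η_ P P') ⊗≫ p ▷ P' := by monoidal
      _ = 𝟙 _ ⊗≫ (A ⊗ P') ◁ η_ P P' ⊗≫ (φ ▷ P ≫ p) ▷ P' := by
          rw [← whisker_exchange]; monoidal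
      _ = 𝟙 _ ⊗≫ A ◁ (P' ◁ η_ P P' ≫ (α_ P' P P').inv ≫ ε_ P P' ▷ P') ⊗≫ 𝟙 _ := by
          rw [hφ]; monoidal
      _ = _ := by rw [ExactPairing.coevaluation_evaluation]; monoidal

/-- The isomorphism `A ≅ A ⊗ A*` of a reflexive object with its internal endomorphism object. -/
def lamIso : A ≅ A ⊗ Aᘁ := actIso R.app R.lamArrow R.ext_app R.lamArrow_app

/-- The outermost `cur` of an abstraction is the name of `e` in `A ⊗ A*`, sent to `A` by `φ`. By
uniqueness of `cur` this reduces to a snake. -/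
theorem cur_leftUnitor (e : A ⟶ A) :
    R.cur ((λ_ A).hom ≫ e) = η_ A Aᘁ ≫ e ▷ Aᘁ ≫ R.lamArrow := by
  symm
  refine R.cur_unique _ _ ?_
  rw [comp_whiskerRight, comp_whiskerRight, Category.assoc, Category.assoc, lamArrow_app]
  calc _ = 𝟙 _ ⊗≫ η_ A Aᘁ ▷ A ⊗≫ (e ▷ (Aᘁ ⊗ A) ≫ A ◁ ε_ A Aᘁ) ⊗≫ 𝟙 _ := by monoidal
    _ = 𝟙 _ ⊗≫ (η_ A Aᘁ ▷ A ≫ (α_ A Aᘁ A).hom ≫ A ◁ ε_ A Aᘁ) ⊗≫ e ⊗≫ 𝟙 _ := by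
        rw [← whisker_exchange]; monoidal
    _ = _ := by rw [ExactPairing.evaluation_coevaluation]; monoidal

variable [BraidedCategory C] [BalancedCategory C]

theorem lam_eq : R.lam = 𝟙 _ ⊗≫ A ◁ revCoev A Aᘁ ⊗≫ R.lamArrow ▷ A := by
  change (ρ_ A).inv ≫ A ◁ revCoev A Aᘁ ≫ (α_ A Aᘁ A).inv ≫ R.lamArrow ▷ A = _
  monoidal

theorem trace_leftUnitor (h : A ⟶ A ⊗ A) : trace A ((λ_ A).hom ≫ h) =
    η_ A Aᘁ ≫ h ▷ Aᘁ ≫ (α_ A A Aᘁ).hom ≫ A ◁ revEv A Aᘁ ≫ (ρ_ A).hom := by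
  rw [trace]
  change _ ≫ _ ≫ _ ≫ _ ≫ _ ≫ A ◁ revEv A Aᘁ ≫ _ = _
  monoidal

variable [RibbonCategory C]

/-- Turning `k` into its mate under `η` leaves `φ` preceded by a bend of `k` with `η'` (from `lam`)
and `ε'` (from the trace). By `mate_eq` this bend is the mate of `k`. -/
theorem trace_lam_whiskerLeft (k : A ⟶ A) :
    η_ A Aᘁ ≫ (R.lam ≫ A ◁ k) ▷ Aᘁ ≫ (α_ A A Aᘁ).hom ≫ A ◁ revEv A Aᘁ ≫ (ρ_ A).hom =
      η_ A Aᘁ ≫ k ▷ Aᘁ ≫ R.lamArrow := by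
  obtain ⟨k', hk⟩ := exists_mate Aᘁ Aᘁ k
  rw [reassoc_of% hk, lam_eq]
  congr 1
  have e := mate_eq (twistCompatible A) hk
  calc _ = 𝟙 _ ⊗≫ A ◁ (revCoev A Aᘁ ▷ Aᘁ) ⊗≫
        (R.lamArrow ▷ (A ⊗ Aᘁ) ≫ A ◁ (k ▷ Aᘁ ≫ revEv A Aᘁ)) ⊗≫ 𝟙 _ := by monoidal
    _ = A ◁ (𝟙 _ ⊗≫ revCoev A Aᘁ ▷ Aᘁ ⊗≫ Aᘁ ◁ (k ▷ Aᘁ ≫ revEv A Aᘁ) ⊗≫ 𝟙 _) ≫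
        R.lamArrow := by
      rw [← whisker_exchange]; monoidal
    _ = _ := by rw [← e]

/-- Under the trace, `lam` followed by `app` on the new variable cancels, as in eta conversion. This
removes one variable in the induction of `trace_lamN`. -/
theorem trace_lam_app (d : A ⟶ A ⊗ A) :
    η_ A Aᘁ ≫ (R.lam ≫ d ▷ A ≫ (α_ A A A).hom ≫ A ◁ R.app) ▷ Aᘁ ≫ (α_ A A Aᘁ).hom ≫
      A ◁ revEv A Aᘁ ≫ (ρ_ A).hom =
    η_ A Aᘁ ≫ d ▷ Aᘁ ≫ (α_ A A Aᘁ).hom ≫ A ◁ revEv A Aᘁ ≫ (ρ_ A).hom := by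
  obtain ⟨g, hg⟩ := exists_mate (Aᘁ ⊗ Aᘁ) Aᘁ R.app
  have e := mate_eq (twistCompatible A) hg
  rw [revCoev_tensor] at e
  -- The isomorphism `A ≅ A ⊗ A*` is `app` with its argument bent away, so next to `η` it can be
  -- traded for the mate of `app`.
  have h₁ : η_ A Aᘁ ≫ R.lamIso.hom ▷ Aᘁ = η_ A Aᘁ ≫ A ◁ g ≫ (α_ A Aᘁ Aᘁ).inv := by
    rw [← reassoc_of% hg, ExactPairing.tensor_coevaluation, lamIso, actIso]
    monoidal
  -- Inserting the isomorphism and its inverse makes the right-hand side contain the `φ` that `lam`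
  -- produces on the left.
  have h₂ : d = R.lamIso.hom ≫ R.lamArrow ≫ d := by
    rw [← Category.assoc]
    exact (Category.id_comp d).symm.trans (by rw [← R.lamIso.hom_inv_id]; rfl)
  rw [lam_eq]
  conv_rhs => rw [h₂, comp_whiskerRight, Category.assoc, reassoc_of% h₁]
  congr 1
  generalize R.lamArrow = φ
  set ω := R.app ▷ Aᘁ ≫ revEv A Aᘁ with hω
  symm
  calc _ = 𝟙 _ ⊗≫ A ◁ (revCoev A Aᘁ ▷ Aᘁ) ⊗≫ ((A ⊗ Aᘁ) ◁ (𝟙 (A ⊗ Aᘁ) ⊗≫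
        revCoev A Aᘁ ▷ (A ⊗ Aᘁ) ⊗≫ Aᘁ ◁ ω ⊗≫ 𝟙 Aᘁ) ≫ (φ ≫ d) ▷ Aᘁ) ⊗≫
        A ◁ revEv A Aᘁ ⊗≫ 𝟙 _ := by rw [e, hω]; monoidal
    _ = 𝟙 _ ⊗≫ A ◁ (revCoev A Aᘁ ▷ Aᘁ) ⊗≫ (φ ≫ d) ▷ (A ⊗ Aᘁ) ⊗≫
        A ◁ A ◁ revCoev A Aᘁ ▷ (A ⊗ Aᘁ) ⊗≫ A ◁ ((A ⊗ Aᘁ) ◁ ω ≫ revEv A Aᘁ ▷ 𝟙_ C) ⊗≫ 𝟙 _ := by rw [whisker_exchange]; monoidal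
    _ = 𝟙 _ ⊗≫ A ◁ (revCoev A Aᘁ ▷ Aᘁ) ⊗≫ (φ ≫ d) ▷ (A ⊗ Aᘁ) ⊗≫
        A ◁ (A ◁ revCoev A Aᘁ ≫ (α_ A Aᘁ A).inv ≫ revEv A Aᘁ ▷ A) ▷ (A ⊗ Aᘁ) ⊗≫ A ◁ ω ⊗≫ 𝟙 _ := by
      rw [whisker_exchange]; monoidal
    -- The only remaining difference is a snake formed by the inner `η'` of `A ⊗ A` and the `ε'` of
    -- the trace.
    _ = _ := by rw [revEv_revCoev (twistCompatible A), hω]; monoidal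

theorem trace_lamN (m : ℕ) (k : A ⊗ tensorPow A m ⟶ A) :
    η_ A Aᘁ ≫ (R.lamN m ≫ R.lam ▷ tensorPow A m ≫ (α_ A A (tensorPow A m)).hom ≫ A ◁ k) ▷ Aᘁ ≫
      (α_ A A Aᘁ).hom ≫ A ◁ revEv A Aᘁ ≫ (ρ_ A).hom = R.cur ((λ_ A).hom ≫ R.curN m k) := by
  induction m with
  | zero =>
    rw [cur_leftUnitor, ← trace_lam_whiskerLeft, lamN, curN]
    simp only [tensorPow]
    monoidal
  | succ m ih =>
    -- The last argument of `k` is exposed as an application, so that `trace_lam_app` removes it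
    -- together with the outermost `lam` of `lamN (m + 1)`.
    have h : k = (α_ A (tensorPow A m) A).inv ≫
        R.cur ((α_ A (tensorPow A m) A).hom ≫ k) ▷ A ≫ R.app := by
      rw [cur_app]; exact (Iso.inv_hom_id_assoc _ _).symm
    rw [curN, ← ih]
    generalize R.cur ((α_ A (tensorPow A m) A).hom ≫ k) = c at h ⊢
    refine Eq.trans ?_ (R.trace_lam_app _)
    rw [h, lamN]
    simp only [tensorPow]
    monoidal

theorem absN_hom_eq_trace {m n : ℕ} (f : tensorPow A m ⟶ tensorPow A n) :
    (R.absN f).hom = trace A ((λ_ A).hom ≫ R.lamN m ≫ (R.lam ⊗ₘ f) ≫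
      (α_ A A (tensorPow A n)).hom ≫ A ◁ R.appN n) := by
  rw [trace_leftUnitor, absN, elt, ← trace_lamN, MonoidalCategory.tensorHom_def]
  simp

end ReflexiveObject

end Abstraction

/-! ### Fullness and faithfulness -/

section FullyFaithful

variable {C : Type*} [Category C] [MonoidalCategory C] 

/-- Injectivity half of the duality bijection between morphisms `Q ⟶ P` and morphisms `P' ⊗ Q ⟶ I`;
`exists_whiskerLeft_evaluation` is the surjectivity half. -/
theorem whiskerLeft_evaluation_injective {P P' Q : C} [ExactPairing P P'] {f g : Q ⟶ P}
    (h : P' ◁ f ≫ ε_ P P' = P' ◁ g ≫ ε_ P P') : f = g := by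
  have e : ∀ f : Q ⟶ P, (tensorLeftHomEquiv Q P P' (𝟙_ C)).symm (f ≫ (ρ_ P).inv) =
      P' ◁ f ≫ ε_ P P' := fun f => by
    simp only [tensorLeftHomEquiv, Equiv.coe_fn_symm_mk]
    monoidal
  rw [← e, ← e] at h
  simpa using (tensorLeftHomEquiv Q P P' (𝟙_ C)).symm.injective h

theorem exists_whiskerLeft_evaluation {P P' Q : C} [ExactPairing P P'] (g : P' ⊗ Q ⟶ 𝟙_ C) :
    ∃ f : Q ⟶ P, P' ◁ f ≫ ε_ P P' = g := by
  obtain ⟨f, hf⟩ := (tensorLeftHomEquiv Q P P' (𝟙_ C)).symm.surjective g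
  refine ⟨f ≫ (ρ_ P).hom, ?_⟩
  rw [← hf]
  simp only [tensorLeftHomEquiv, Equiv.coe_fn_symm_mk]
  monoidal

/-- Surrounding `A ⊗ u` by `c` and `ε` creates a detached loop `c;ε = id` beside `u`, so `u` is
recovered from `A ⊗ u`. -/
theorem whiskerLeft_injective {A A' Z : C} [ExactPairing A A'] {c : 𝟙_ C ⟶ A' ⊗ A}
    (hc : c ≫ ε_ A A' = 𝟙 _) {u v : Z ⟶ 𝟙_ C} (h : A ◁ u = A ◁ v) : u = v := by
  have e : ∀ u : Z ⟶ 𝟙_ C, u = 𝟙 _ ⊗≫ c ▷ Z ⊗≫ A' ◁ (A ◁ u) ⊗≫ ε_ A A' := fun u => by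
    calc u = 𝟙 _ ⊗≫ (c ≫ ε_ A A') ▷ Z ⊗≫ u := by rw [hc]; monoidal
      _ = 𝟙 _ ⊗≫ c ▷ Z ⊗≫ (ε_ A A' ▷ Z ≫ 𝟙_ C ◁ u) ⊗≫ 𝟙 _ := by monoidal
      _ = _ := by rw [← whisker_exchange]; monoidal
  rw [e u, e v, h]

namespace ReflexiveObject

variable {A : C} (R : ReflexiveObject A)

/-- The composition `A ⊗ A ⟶ A` of a function with an `n`-ary function. -/
def compN (n : ℕ) : A ⊗ A ⟶ A := R.act (Bpow n) ▷ A ≫ R.app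

/-- The arity equation read as a diagram: applying a function to the value of `a` at an `n`-ary
function equals the value of `a` at their composite. So `a` acts on functions by precomposition. -/
theorem whiskerLeft_act_of_hasArity {m n : ℕ} {a : R.Elt} (h : HasArity m n a) :
    A ◁ (R.act a ▷ tensorPow A m ≫ R.appN m) ≫ R.app = (α_ A A (tensorPow A m)).inv ≫
      R.compN n ▷ tensorPow A m ≫ R.act a ▷ tensorPow A m ≫ R.appN m := by
  have h' := congrArg (fun x => R.act x ▷ A ≫ R.app) h
  have e₁ : R.act (bul a * Bpow (m + 1)) ▷ A ≫ R.app =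
      A ◁ R.act a ≫ R.act (Bpow m) ▷ A ≫ R.app := by
    rw [show Bpow (m + 1) = (B * Bpow m : R.Elt) from rfl, act_mul, act_mul, Category.assoc,
      comp_whiskerRight, Category.assoc, act_B_bul, whisker_exchange_assoc]
  have e₂ : R.act ((B ⬝ a) * Bpow n) ▷ A ≫ R.app = R.compN n ≫ R.act a := by
    rw [act_mul, comp_whiskerRight, Category.assoc, act_B_ap, compN, Category.assoc]
  simp only [e₁, e₂] at h'
  rw [← comp_whiskerRight_assoc, ← h', Iso.eq_inv_comp, comp_whiskerRight, Category.assoc,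
    (R.isAct_appN m).pow]
  monoidal

variable [RightRigidCategory C]

/-- `cur^n(A ⊗ ε) : A ⊗ (A^{⊗ n})* ⟶ A` -/
def lamArrowN (n : ℕ) : A ⊗ (tensorPow A n)ᘁ ⟶ A :=
  R.curN n ((α_ A (tensorPow A n)ᘁ (tensorPow A n)).hom ≫ A ◁ ε_ _ _ ≫ (ρ_ A).hom)

theorem lamArrowN_appN (n : ℕ) : R.lamArrowN n ▷ tensorPow A n ≫ R.appN n =
    (α_ A (tensorPow A n)ᘁ (tensorPow A n)).hom ≫ A ◁ ε_ _ _ ≫ (ρ_ A).hom :=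
  R.curN_app n _

instance (n : ℕ) : IsIso (R.lamArrowN n) :=
  inferInstanceAs (IsIso (actIso (R.appN n) (R.lamArrowN n) (R.isAct_appN n).inj
    (R.lamArrowN_appN n)).inv)

/-- After precomposition with the isomorphism `lamArrowN n`, applying to `f` becomes `A` tensored
with the transpose of `f`; hence `f` can be recovered once `A ⊗ _` can be cancelled. -/
theorem lamArrowN_whiskerLeft {n : ℕ} {Q : C} (f : Q ⟶ tensorPow A n) :
    R.lamArrowN n ▷ Q ≫ A ◁ f ≫ R.appN n =
      (α_ A (tensorPow A n)ᘁ Q).hom ≫ A ◁ ((tensorPow A n)ᘁ ◁ f ≫ ε_ _ _) ≫ (ρ_ A).hom := by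
  rw [← whisker_exchange_assoc, lamArrowN_appN]
  monoidal

variable {c : 𝟙_ C ⟶ Aᘁ ⊗ A} (hc : c ≫ ε_ A Aᘁ = 𝟙 _)

include hc in
theorem whiskerLeft_appN_injective {n : ℕ} {Q : C} {f g : Q ⟶ tensorPow A n}
    (h : A ◁ f ≫ R.appN n = A ◁ g ≫ R.appN n) : f = g := by
  have e := R.lamArrowN_whiskerLeft f
  rw [h, lamArrowN_whiskerLeft] at e
  refine whiskerLeft_evaluation_injective (P' := (tensorPow A n)ᘁ) (whiskerLeft_injective hc ?_)
  simpa using e.symm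

/-- Under `A ≅ A ⊗ A*` and `A ≅ A ⊗ (A^{⊗ n})*`, internal composition is contraction of the middle
pair `A* ⊗ A`. It is tested by applying both sides to `n` arguments, which is injective. -/
theorem lamArrow_compN (n : ℕ) : (A ⊗ Aᘁ) ◁ R.lamArrowN n ≫ R.lamArrow ▷ A ≫ R.compN n =
    𝟙 _ ⊗≫ A ◁ (ε_ A Aᘁ ▷ (tensorPow A n)ᘁ) ⊗≫ R.lamArrowN n := by
  refine (R.isAct_appN n).inj ?_
  have h₁ : R.compN n ▷ tensorPow A n ≫ R.appN n = _ := (R.isAct_appN n).pow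
  have h₂ := R.lamArrowN_appN n
  have h₃ := R.lamArrow_app
  generalize R.lamArrowN n = φ at *
  generalize R.lamArrow = ψ at *
  generalize R.compN n = k at *
  generalize R.appN n = p at *
  generalize tensorPow A n = P at *
  calc _ = (𝟙 _ ⊗≫ (A ⊗ Aᘁ) ◁ (φ ▷ P) ⊗≫ ψ ▷ (A ⊗ P) ⊗≫ 𝟙 _) ≫ k ▷ P ≫ p := by monoidal
    _ = 𝟙 _ ⊗≫ (A ⊗ Aᘁ) ◁ (φ ▷ P) ⊗≫ (ψ ▷ (A ⊗ P) ≫ A ◁ p) ≫ R.app := by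
      rw [h₁]; monoidal
    _ = 𝟙 _ ⊗≫ (A ⊗ Aᘁ) ◁ (φ ▷ P ≫ p) ⊗≫ ψ ▷ A ≫ R.app := by
      rw [← whisker_exchange]; monoidal
    _ = 𝟙 _ ⊗≫ A ◁ (((Aᘁ ⊗ A) ◁ ε_ P Pᘁ) ≫ ε_ A Aᘁ ▷ 𝟙_ C) ⊗≫ 𝟙 _ := by
      rw [h₂, h₃]; monoidal
    _ = 𝟙 _ ⊗≫ A ◁ (ε_ A Aᘁ ▷ (Pᘁ ⊗ P)) ⊗≫ ((α_ A Pᘁ P).hom ≫ A ◁ ε_ P Pᘁ ≫ (ρ_ A).hom) := by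
      rw [whisker_exchange]; monoidal
    _ = _ := by rw [← h₂]; monoidal

include hc in
-- This is fullness: commuting with composition in the function argument forces the action of `a` to
-- leave the result wire `A` untouched, and what remains is a morphism of `C`.
theorem exists_rep {m n : ℕ} {a : R.Elt} (ha : HasArity m n a) :
    ∃ f : tensorPow A m ⟶ tensorPow A n, Rep (R.appN m) (R.appN n) (R.act a) f := by
  have hE := R.whiskerLeft_act_of_hasArity ha
  have hK := R.lamArrow_compN n
  have h₃ := R.lamArrow_app
  have h₄ := fun f : tensorPow A m ⟶ tensorPow A n => R.lamArrowN_whiskerLeft f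
  -- Recorded before `generalize` makes the morphism opaque, since `φ ▷ Q` is cancelled at the end.
  have h₅ : IsIso (R.lamArrowN n) := inferInstance
  unfold Rep
  generalize R.act a ▷ tensorPow A m ≫ R.appN m = h at *
  generalize R.lamArrowN n = φ at *
  generalize R.lamArrow = ψ at *
  generalize R.compN n = k at *
  generalize R.appN n = p at *
  generalize tensorPow A n = P at *
  generalize tensorPow A m = Q at *
  -- The commutation with composition, transported along `φ` and `ψ`: contracting a pair `A* ⊗ A`
  -- after the map equals contracting it before the map.
  have hw : 𝟙 _ ⊗≫ A ◁ (Aᘁ ◁ (φ ▷ Q ≫ h) ≫ ε_ A Aᘁ) ⊗≫ 𝟙 _ =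
      𝟙 (A ⊗ (Aᘁ ⊗ ((A ⊗ Pᘁ) ⊗ Q))) ⊗≫ A ◁ (ε_ A Aᘁ ▷ (Pᘁ ⊗ Q)) ⊗≫ φ ▷ Q ≫ h := by
    calc _ = 𝟙 _ ⊗≫ (A ⊗ Aᘁ) ◁ (φ ▷ Q) ⊗≫ ((A ⊗ Aᘁ) ◁ h ≫ ψ ▷ A) ≫ R.app := by
          rw [Category.assoc, h₃]; monoidal
      _ = 𝟙 _ ⊗≫ (A ⊗ Aᘁ) ◁ (φ ▷ Q) ⊗≫ ψ ▷ (A ⊗ Q) ≫ A ◁ h ≫ R.app := by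
          rw [whisker_exchange]; monoidal
      _ = 𝟙 _ ⊗≫ ((A ⊗ Aᘁ) ◁ φ ≫ ψ ▷ A ≫ k) ▷ Q ≫ h := by rw [hE]; monoidal
      _ = _ := by rw [hK]; monoidal
  -- The transpose of `f` is `φ ▷ Q ≫ h` with its result wire `A` closed up by `c` and `ε`. Filling
  -- the contracted pair in `hw` with `c` shows that `A` tensored with it is `φ ▷ Q ≫ h`.
  obtain ⟨f, hf⟩ := exists_whiskerLeft_evaluation (P := P)
    (𝟙 (Pᘁ ⊗ Q) ⊗≫ c ▷ (Pᘁ ⊗ Q) ⊗≫ Aᘁ ◁ (φ ▷ Q ≫ h) ≫ ε_ A Aᘁ)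
  refine ⟨f, ?_⟩
  rw [← cancel_epi (φ ▷ Q), h₄, hf]
  calc φ ▷ Q ≫ h = 𝟙 _ ⊗≫ A ◁ ((c ≫ ε_ A Aᘁ) ▷ (Pᘁ ⊗ Q)) ⊗≫ φ ▷ Q ≫ h := by
        rw [hc]; monoidal
    _ = 𝟙 _ ⊗≫ A ◁ (c ▷ (Pᘁ ⊗ Q)) ⊗≫
        (𝟙 (A ⊗ (Aᘁ ⊗ ((A ⊗ Pᘁ) ⊗ Q))) ⊗≫ A ◁ (ε_ A Aᘁ ▷ (Pᘁ ⊗ Q)) ⊗≫ φ ▷ Q ≫ h) := by monoidal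
    _ = _ := by rw [← hw]; monoidal

include hc in
theorem internalFunctor_faithful : R.internalFunctor.Faithful where
  map_injective {X Y f g} h := by
    refine TensorPowers.hom_ext (R.whiskerLeft_appN_injective hc ?_)
    have e : R.absN (TensorPowers.Hom.hom f) = R.absN (TensorPowers.Hom.hom g) :=
      congrArg InternalPRO.val h
    have h₁ := R.rep_absN (TensorPowers.Hom.hom f)
    have h₂ := R.rep_absN (TensorPowers.Hom.hom g)
    rw [e] at h₁
    exact h₁.symm.trans h₂

include hc in
theorem internalFunctor_full : R.internalFunctor.Full where
  map_surjective {X Y} f := by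
    obtain ⟨g, hg⟩ := R.exists_rep hc (InternalPRO.val_arity f)
    exact ⟨⟨g⟩, InternalPRO.hom_ext
      (R.act_injective ((R.isAct_appN _).rep_unique (R.rep_absN g) hg))⟩

instance : R.internalFunctor.EssSurj where
  mem_essImage X := ⟨⟨X.len⟩, ⟨Iso.refl _⟩⟩

end ReflexiveObject

section

variable [BraidedCategory C] [BalancedCategory C] [RightRigidCategory C]

theorem loop_eq (X : C) : loop X = revCoev X Xᘁ ≫ ε_ X Xᘁ := by
  rw [revCoev_evaluation, loop, trace]
  change _ ≫ _ ≫ _ ≫ _ ≫ _ ≫ 𝟙_ C ◁ revEv X Xᘁ ≫ _ = _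
  monoidal

end

end FullyFaithful

/-! ### `F` preserves tensor product, braiding and twist -/

section Monoidal

open ExtBIAlgebra TensorPowers

variable {C : Type*} [Category C] [MonoidalCategory C]

namespace ReflexiveObject

variable {A : C} (R : ReflexiveObject A)

/-- Representing elements are unique, so a value of `F` is found by guessing an element and checking
that it acts as required. -/
theorem absN_eq_of_rep {m n : ℕ} {f : tensorPow A m ⟶ tensorPow A n} {a : R.Elt}
    (h : Rep (R.appN m) (R.appN n) (R.act a) f) : R.absN f = a :=
  R.act_injective ((R.isAct_appN m).rep_unique (R.rep_absN f) h)

/-- Coherence isomorphisms do not affect iterated application; by this criterion `F` sends them to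
the identity, whence its strictness. -/
theorem absN_eq_one {m n : ℕ} {f : tensorPow A m ⟶ tensorPow A n}
    (h : A ◁ f ≫ R.appN n = R.appN m) : R.absN f = 1 :=
  R.absN_eq_of_rep (by rw [Rep, act_one, h]; simp)

theorem powAdd_appN (m n : ℕ) : A ◁ (powAdd A m n).hom ≫ R.appN (m + n) =
    (α_ A (tensorPow A m) (tensorPow A n)).inv ≫ R.appN m ▷ tensorPow A n ≫ R.appN n := by
  induction n with
  | zero =>
    change A ◁ (ρ_ (tensorPow A m)).hom ≫ R.appN m =
      (α_ A (tensorPow A m) (𝟙_ C)).inv ≫ R.appN m ▷ 𝟙_ C ≫ (ρ_ A).hom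
    monoidal
  | succ n ih =>
    change A ◁ ((α_ (tensorPow A m) (tensorPow A n) A).inv ≫ (powAdd A m n).hom ▷ A) ≫
      (α_ A (tensorPow A (m + n)) A).inv ≫ R.appN (m + n) ▷ A ≫ R.app =
      (α_ A (tensorPow A m) (tensorPow A n ⊗ A)).inv ≫ R.appN m ▷ (tensorPow A n ⊗ A) ≫
        (α_ A (tensorPow A n) A).inv ≫ R.appN n ▷ A ≫ R.app
    calc _ = 𝟙 _ ⊗≫ (A ◁ (powAdd A m n).hom ≫ R.appN (m + n)) ▷ A ≫ R.app := by monoidal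
      _ = _ := by rw [ih]; monoidal

theorem powAdd_inv_appN (m n : ℕ) : A ◁ (powAdd A m n).inv ≫
    (α_ A (tensorPow A m) (tensorPow A n)).inv ≫ R.appN m ▷ tensorPow A n ≫ R.appN n =
      R.appN (m + n) := by
  rw [← powAdd_appN, whiskerLeft_inv_hom_assoc]

/-- Each `B` lets `a` act after one more application, `B a f x = a (f x)`. This is why tensoring
with `k` on the left prefixes `k` copies of `B`. -/
theorem appN_act (k : ℕ) (a : R.Elt) :
    R.appN k ≫ R.act a = R.act (lft k a) ▷ tensorPow A k ≫ R.appN k := by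
  induction k generalizing a with
  | zero => exact (rightUnitor_naturality _).symm
  | succ k ih =>
    change ((α_ A (tensorPow A k) A).inv ≫ R.appN k ▷ A ≫ R.app) ≫ R.act a =
      R.act (lft (k + 1) a) ▷ (tensorPow A k ⊗ A) ≫
        (α_ A (tensorPow A k) A).inv ≫ R.appN k ▷ A ≫ R.app
    rw [Category.assoc, Category.assoc, ← act_B_ap, lft_succ', ← comp_whiskerRight_assoc, ih]
    simp

theorem absN_whiskerRight {m n : ℕ} (f : tensorPow A m ⟶ tensorPow A n) (k : ℕ) :
    R.absN ((powAdd A m k).inv ≫ f ▷ tensorPow A k ≫ (powAdd A n k).hom) = R.absN f := by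
  refine R.absN_eq_of_rep ?_
  have h := R.rep_absN f
  unfold Rep at h ⊢
  simp only [whiskerLeft_comp, Category.assoc, powAdd_appN]
  rw [associator_inv_naturality_middle_assoc, ← comp_whiskerRight_assoc, ← h,
    comp_whiskerRight, Category.assoc, ← associator_inv_naturality_left_assoc,
    whisker_exchange_assoc, powAdd_inv_appN]

theorem absN_whiskerLeft {m n : ℕ} (f : tensorPow A m ⟶ tensorPow A n) (k : ℕ) :
    R.absN ((powAdd A k m).inv ≫ tensorPow A k ◁ f ≫ (powAdd A k n).hom) = lft k (R.absN f) := by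
  refine R.absN_eq_of_rep ?_
  have h := R.rep_absN f
  unfold Rep at h ⊢
  simp only [whiskerLeft_comp, Category.assoc, powAdd_appN]
  rw [associator_inv_naturality_right_assoc, whisker_exchange_assoc, ← h,
    ← comp_whiskerRight_assoc, appN_act, comp_whiskerRight, Category.assoc,
    ← associator_inv_naturality_left_assoc, whisker_exchange_assoc, powAdd_inv_appN]

theorem absN_associator (X Y Z : TensorPowers A) : R.absN (Hom.hom (α_ X Y Z).hom) = 1 := by
  refine R.absN_eq_one ?_
  change A ◁ ((powAdd A (X.len + Y.len) Z.len).inv ≫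
    (powAdd A X.len Y.len).inv ▷ tensorPow A Z.len ≫ (α_ _ _ _).hom ≫
    tensorPow A X.len ◁ (powAdd A Y.len Z.len).hom ≫
      (powAdd A X.len (Y.len + Z.len)).hom) ≫ R.appN (X.len + (Y.len + Z.len)) =
    R.appN (X.len + Y.len + Z.len)
  simp only [whiskerLeft_comp, Category.assoc, powAdd_appN]
  rw [associator_inv_naturality_right_assoc, whisker_exchange_assoc, powAdd_appN]
  calc _ = A ◁ (powAdd A (X.len + Y.len) Z.len).inv ≫ (α_ _ _ _).inv ≫
        (A ◁ (powAdd A X.len Y.len).inv ≫ (α_ _ _ _).inv ≫ R.appN X.len ▷ tensorPow A Y.len ≫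
          R.appN Y.len) ▷ tensorPow A Z.len ≫ R.appN Z.len := by monoidal
    _ = _ := by rw [powAdd_inv_appN, powAdd_inv_appN]

theorem absN_leftUnitor (X : TensorPowers A) : R.absN (Hom.hom (λ_ X).hom) = 1 := by
  refine R.absN_eq_one ?_
  change A ◁ ((powAdd A 0 X.len).inv ≫ (λ_ (tensorPow A X.len)).hom) ≫ R.appN X.len =
    R.appN (0 + X.len)
  rw [← powAdd_inv_appN]
  change _ = _ ≫ (α_ A (𝟙_ C) _).inv ≫ (ρ_ A).hom ▷ _ ≫ _
  monoidal

theorem absN_rightUnitor (X : TensorPowers A) : R.absN (Hom.hom (ρ_ X).hom) = 1 := by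
  refine R.absN_eq_one ?_
  change A ◁ ((powAdd A X.len 0).inv ≫ (ρ_ (tensorPow A X.len)).hom) ≫ R.appN X.len =
    R.appN (X.len + 0)
  rw [← powAdd_inv_appN]
  change _ = _ ≫ (α_ A _ (𝟙_ C)).inv ≫ _ ▷ (𝟙_ C) ≫ (ρ_ A).hom
  monoidal

theorem absN_iso_inv {X Y : TensorPowers A} (e : X ≅ Y) (h : R.absN (Hom.hom e.hom) = 1) :
    R.absN (Hom.hom e.inv) = 1 := by
  have h' := R.absN_comp (Hom.hom e.hom) (Hom.hom e.inv)
  rw [← comp_hom, e.hom_inv_id, id_hom, absN_id, h, one_mul] at h'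
  exact h'.symm

@[simp] theorem val_internalFunctor_map {X Y : TensorPowers A} (f : X ⟶ Y) :
    InternalPRO.val (R.internalFunctor.map f) = R.absN (Hom.hom f) := rfl

/-- `F` is strict monoidal. -/
def internalFunctorCoreMonoidal : R.internalFunctor.CoreMonoidal where
  εIso := InternalPRO.isoOfEq rfl
  μIso X Y := InternalPRO.isoOfEq rfl
  μIso_hom_natural_left {X Y} f Z := by
    ext
    change R.absN (Hom.hom f) * 1 = 1 * _
    rw [mul_one, one_mul]
    exact (R.absN_whiskerRight (Hom.hom f) Z.len).symm
  μIso_hom_natural_right {X Y} Z f := by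
    ext
    change lft Z.len (R.absN (Hom.hom f)) * 1 = 1 * _
    rw [mul_one, one_mul]
    exact (R.absN_whiskerLeft (Hom.hom f) Z.len).symm
  associativity X Y Z := by
    ext
    change 1 * (1 * R.absN (Hom.hom (α_ X Y Z).hom)) = 1 * (lft X.len 1 * 1)
    simp [absN_associator, lft_one]
  left_unitality X := by
    ext
    change 1 = 1 * (1 * R.absN (Hom.hom (λ_ X).hom))
    simp [absN_leftUnitor]
  right_unitality X := by
    ext
    change 1 = lft X.len 1 * (1 * R.absN (Hom.hom (ρ_ X).hom))
    simp [absN_rightUnitor, lft_one]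

instance : R.internalFunctor.Monoidal := R.internalFunctorCoreMonoidal.toMonoidal

theorem val_ε : InternalPRO.val (Functor.LaxMonoidal.ε R.internalFunctor) = 1 := rfl

theorem val_μ (X Y : TensorPowers A) :
    InternalPRO.val (Functor.LaxMonoidal.μ R.internalFunctor X Y) = 1 := rfl

theorem absN_hom_whiskerRight {X Y : TensorPowers A} (f : X ⟶ Y) (Z : TensorPowers A) :
    R.absN (Hom.hom (f ▷ Z)) = R.absN (Hom.hom f) :=
  R.absN_whiskerRight (Hom.hom f) Z.len

theorem absN_hom_whiskerLeft {X Y : TensorPowers A} (Z : TensorPowers A) (f : X ⟶ Y) :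
    R.absN (Hom.hom (Z ◁ f)) = lft Z.len (R.absN (Hom.hom f)) :=
  R.absN_whiskerLeft (Hom.hom f) Z.len

/-- The power `A^{⊗ 1}` is `I ⊗ A` rather than `A`. The unitor between them is invisible to
abstraction, so the combinators defined on `A` may be compared with `F` at `1`. -/
theorem rep_tensorPow_one : Rep (R.appN 1) R.app (𝟙 A) (λ_ A).hom := by
  change 𝟙 A ▷ (𝟙_ C ⊗ A) ≫ (α_ A (𝟙_ C) A).inv ≫ (ρ_ A).hom ▷ A ≫ R.app = _
  monoidal

theorem rep_tensorPow_one_inv : Rep R.app (R.appN 1) (𝟙 A) (λ_ A).inv := by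
  change _ = _ ≫ (α_ A (𝟙_ C) A).inv ≫ (ρ_ A).hom ▷ A ≫ R.app
  monoidal

section

variable [BraidedCategory C]

open BalancedExtBIAlgebra

/-- Here `e` stands for `powAdd A 1 1`, which removes only the unit of the second factor; naturality
of the braiding removes the other one. -/
theorem braiding_conj (e : (𝟙_ C ⊗ A) ⊗ (𝟙_ C ⊗ A) ≅ (𝟙_ C ⊗ A) ⊗ A)
    (p : e.hom = (𝟙_ C ⊗ A) ◁ (λ_ A).hom) :
    e.inv ≫ (β_ (𝟙_ C ⊗ A) (𝟙_ C ⊗ A)).hom ≫ e.hom =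
      (λ_ A).hom ▷ A ≫ (β_ A A).hom ≫ (λ_ A).inv ▷ A := by
  rw [Iso.inv_comp_eq, p, ← BraidedCategory.braiding_naturality_left, whisker_exchange_assoc,
    BraidedCategory.braiding_naturality_right_assoc, ← comp_whiskerRight, Iso.hom_inv_id,
    id_whiskerRight, Category.comp_id]

theorem absN_braiding_one : R.absN (Hom.hom (β_ (⟨1⟩ : TensorPowers A) ⟨1⟩).hom) =
    R.abs₂ (β_ A A).hom := by
  refine R.absN_eq_of_rep ?_
  have h := (R.rep_tensorPow_one.whiskerRight).comp
    ((rep_abs₂ (R := R) (β_ A A).hom).comp R.rep_tensorPow_one_inv.whiskerRight)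
  have e : Hom.hom (β_ (⟨1⟩ : TensorPowers A) ⟨1⟩).hom =
      (λ_ A).hom ▷ A ≫ (β_ A A).hom ≫ (λ_ A).inv ▷ A := by
    rw [braiding_hom_hom]
    have p : (powAdd A 1 1).hom = (𝟙_ C ⊗ A) ◁ (λ_ A).hom := by
      change (α_ (𝟙_ C ⊗ A) (𝟙_ C) A).inv ≫ (ρ_ (𝟙_ C ⊗ A)).hom ▷ A = _
      monoidal
    exact braiding_conj (powAdd A 1 1) p
  rw [e]
  simp only [Category.id_comp, Category.comp_id] at h
  exact h

theorem absN_braiding_tensor_right (X Y Z : TensorPowers A) :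
    R.absN (Hom.hom (β_ X (Y ⊗ Z)).hom) =
      R.absN (Hom.hom (β_ X Y).hom) * lft Y.len (R.absN (Hom.hom (β_ X Z).hom)) := by
  rw [BraidedCategory.braiding_tensor_right_hom]
  simp only [comp_hom, absN_comp, absN_associator, absN_iso_inv, absN_hom_whiskerLeft,
    absN_hom_whiskerRight, one_mul, mul_one]

theorem absN_braiding_tensor_left (X Y Z : TensorPowers A) :
    R.absN (Hom.hom (β_ (X ⊗ Y) Z).hom) =
      lft X.len (R.absN (Hom.hom (β_ Y Z).hom)) * R.absN (Hom.hom (β_ X Z).hom) := by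
  rw [BraidedCategory.braiding_tensor_left_hom]
  simp only [comp_hom, absN_comp, absN_associator, absN_iso_inv, absN_hom_whiskerLeft,
    absN_hom_whiskerRight, one_mul, mul_one]

theorem absN_braiding_unit_right (X : TensorPowers A) :
    R.absN (Hom.hom (β_ X (𝟙_ (TensorPowers A))).hom) = 1 := by
  rw [braiding_tensorUnit_right, comp_hom, absN_comp, absN_rightUnitor,
    R.absN_iso_inv _ (R.absN_leftUnitor X), one_mul]

theorem absN_braiding_unit_left (X : TensorPowers A) :
    R.absN (Hom.hom (β_ (𝟙_ (TensorPowers A)) X).hom) = 1 := by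
  rw [braiding_tensorUnit_left, comp_hom, absN_comp, absN_leftUnitor,
    R.absN_iso_inv _ (R.absN_rightUnitor X), one_mul]

variable [BalancedCategory C]

theorem absN_braiding_one_right (m : ℕ) : R.absN (Hom.hom (β_ (⟨m⟩ : TensorPowers A) ⟨1⟩).hom) =
    braid (Cp : R.Elt) m 1 := by
  induction m with
  | zero => rw [braid_zero_left]; exact R.absN_braiding_unit_left ⟨1⟩
  | succ m ih =>
    rw [braid_add_left arity_Cp, ← ih, braid_one_one]
    exact (R.absN_braiding_tensor_left ⟨m⟩ ⟨1⟩ ⟨1⟩).trans (by rw [absN_braiding_one]; rfl)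

/-- Both families of braidings satisfy the hexagons, which determine them from the value `C⁺` at
`(1, 1)`. -/
theorem absN_braiding (m n : ℕ) : R.absN (Hom.hom (β_ (⟨m⟩ : TensorPowers A) ⟨n⟩).hom) =
    braid (Cp : R.Elt) m n := by
  induction n with
  | zero => exact R.absN_braiding_unit_right ⟨m⟩
  | succ n ih =>
    rw [braid_add_right, ← ih, ← absN_braiding_one_right]
    exact R.absN_braiding_tensor_right ⟨m⟩ ⟨n⟩ ⟨1⟩

instance : R.internalFunctor.Braided where
  braided X Y := by
    ext
    change 1 * R.absN (Hom.hom (β_ X Y).hom) = braid (Cp : R.Elt) X.len Y.len * 1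
    rw [one_mul, mul_one, ← absN_braiding]

theorem absN_twist_one : R.absN (Hom.hom (BalancedCategory.twist (⟨1⟩ : TensorPowers A)).hom) =
    R.abs₁ (BalancedCategory.twist A).hom := by
  refine R.absN_eq_of_rep ?_
  have h := R.rep_tensorPow_one.comp
    ((rep_abs₁ (R := R) (BalancedCategory.twist A).hom).comp R.rep_tensorPow_one_inv)
  have e : Hom.hom (BalancedCategory.twist (⟨1⟩ : TensorPowers A)).hom =
      (λ_ A).hom ≫ (BalancedCategory.twist A).hom ≫ (λ_ A).inv := by
    change (BalancedCategory.twist (𝟙_ C ⊗ A)).hom = _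
    rw [← Category.assoc, BalancedCategory.twist_naturality, Category.assoc,
      Iso.hom_inv_id, Category.comp_id]
  rw [e]
  simp only [Category.id_comp, Category.comp_id] at h
  exact h

theorem absN_twist (m : ℕ) :
    R.absN (Hom.hom (BalancedCategory.twist (⟨m⟩ : TensorPowers A)).hom) =
      twistElt (Cp : R.Elt) θp m := by
  induction m with
  | zero =>
    have h : (BalancedCategory.twist (tensorPow A 0)).hom = 𝟙 _ := twist_unit
    change R.absN (BalancedCategory.twist (tensorPow A 0)).hom = 1
    rw [h, absN_id]
  | succ m ih =>
    -- The recursion of `twistElt` is not unfolded: the twist axiom for `m ⊗ 1` holds in both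
    -- categories, and its ingredients already correspond under `F`.
    have h := congrArg (fun f => R.absN (Hom.hom f))
      (BalancedCategory.twist_tensor (⟨m⟩ : TensorPowers A) ⟨1⟩)
    have h' := congrArg InternalPRO.val
      (BalancedCategory.twist_tensor (⟨m⟩ : InternalPRO R.Elt) ⟨1⟩)
    refine h.trans (Eq.trans ?_ h'.symm)
    rw [MonoidalCategory.tensorHom_def, MonoidalCategory.tensorHom_def]
    simp only [comp_hom, absN_comp, absN_hom_whiskerLeft, absN_hom_whiskerRight, absN_braiding, ih,
      absN_twist_one, InternalPRO.val_comp, InternalPRO.val_whiskerRight,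
      InternalPRO.val_whiskerLeft, InternalPRO.val_braiding_hom]
    change _ = _ * (twistElt (Cp : R.Elt) θp 1 * lft 1 (twistElt (Cp : R.Elt) θp m) * _)
    rw [twist_one]
    rfl

theorem internalFunctor_map_twist (X : TensorPowers A) :
    R.internalFunctor.map (BalancedCategory.twist X).hom =
      (BalancedCategory.twist (R.internalFunctor.obj X)).hom := by
  ext
  exact R.absN_twist X.len

end

end ReflexiveObject

end Monoidal

/-! ### Self-duality and the ribbon structures -/

section Duals

open BalancedCategory TensorPowers ExtBIAlgebra

section

variable {C : Type*} [Category C] [MonoidalCategory C]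

theorem coevaluation_whiskerLeft_injective {X X' Z : C} [ExactPairing X X'] {f g : X' ⟶ Z}
    (h : η_ X X' ≫ X ◁ f = η_ X X' ≫ X ◁ g) : f = g := by
  have e : ∀ f : X' ⟶ Z, tensorLeftHomEquiv (𝟙_ C) X X' Z ((ρ_ X').hom ≫ f) =
      η_ X X' ≫ X ◁ f := fun f => by
    simp only [tensorLeftHomEquiv, Equiv.coe_fn_mk]
    monoidal
  rw [← e, ← e] at h
  simpa using (tensorLeftHomEquiv (𝟙_ C) X X' Z).injective h

variable [BraidedCategory C] [BalancedCategory C]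

/-- A morphism out of a dual is determined by its composite with `η`, and that composite of the mate
of the twist is known. -/
theorem ribbonCategory_of_twistCompatible [RightRigidCategory C]
    (h : ∀ X : C, TwistCompatible X Xᘁ) : RibbonCategory C where
  twist_dual X := coevaluation_whiskerLeft_injective (by
    rw [coevaluation_comp_rightAdjointMate, h])

/-- Two duals of `X` are related by the mate of the identity, and the twist is natural with respect
to it. So the pairings on tensor powers may be chosen without regard to the twist. -/
theorem TwistCompatible.of_pairing {X Y Z : C} [ExactPairing X Y] [ExactPairing X Z]
    (h : TwistCompatible X Y) : TwistCompatible X Z := by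
  obtain ⟨g, hg⟩ := exists_mate Z Y (𝟙 X)
  rw [id_whiskerRight, Category.comp_id] at hg
  rw [TwistCompatible, hg, Category.assoc, Category.assoc, whisker_exchange, reassoc_of% h,
    ← whiskerLeft_comp, ← whiskerLeft_comp, twist_naturality]

end

variable {C : Type*} [Category C] [MonoidalCategory C] [BraidedCategory C]

namespace ReflexiveObject

variable {A : C} (R : ReflexiveObject A) [RightRigidCategory C]

/-- A reflexive object with a dual in a braided category is its own dual. -/
abbrev selfPairing : ExactPairing A A :=
  letI := BraidedCategory.exactPairing_swap A Aᘁ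
  -- Dualising reverses the factors, and the braiding makes `A` a dual of `A*`; hence `A ⊗ A*` is
  -- its own dual, and `A` inherits this through `lamIso`.
  letI : ExactPairing (A ⊗ Aᘁ) (A ⊗ Aᘁ) := ExactPairing.tensor
  exactPairingCongr R.lamIso R.lamIso

/-- The tensor powers of a reflexive object are their own duals. -/
abbrev tensorPowPairing : ∀ n : ℕ, ExactPairing (tensorPow A n) (tensorPow A n)
  | 0 => exactPairingUnit
  | n + 1 =>
    letI := R.selfPairing
    letI := tensorPowPairing n
    -- Duality reverses the order of the factors; the braiding restores it.
    letI : ExactPairing (tensorPow A n ⊗ A) (A ⊗ tensorPow A n) := ExactPairing.tensor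
    (exactPairingCongrRight (β_ (tensorPow A n) A) :
      ExactPairing (tensorPow A n ⊗ A) (tensorPow A n ⊗ A))

/-- Every object of `C|_A` is its own dual. -/
noncomputable abbrev tensorPowersPairing (X : TensorPowers A) : ExactPairing X X :=
  letI : ExactPairing ((incl A).obj X) ((incl A).obj X) := R.tensorPowPairing X.len
  ExactPairing.ofFullyFaithful (incl A) X X

/-- `C|_A` has duals. -/
noncomputable abbrev tensorPowersRigid : RightRigidCategory (TensorPowers A) where
  rightDual X := { rightDual := X, exact := R.tensorPowersPairing X }

theorem tensorPowersPairing_coevaluation_hom (X : TensorPowers A) :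
    letI := R.tensorPowersPairing X
    letI := R.tensorPowPairing X.len
    Hom.hom (η_ X X) = η_ (tensorPow A X.len) (tensorPow A X.len) ≫
      (powAdd A X.len X.len).hom := by
  let : ExactPairing ((incl A).obj X) ((incl A).obj X) := R.tensorPowPairing X.len
  have h : (incl A).map (@ExactPairing.coevaluation _ _ _ X X (R.tensorPowersPairing X)) =
      Functor.OplaxMonoidal.η (incl A) ≫ η_ _ _ ≫ Functor.LaxMonoidal.μ (incl A) X X :=
    (incl A).map_preimage _
  refine h.trans ?_
  exact Category.id_comp _

/-- The image under `F` of a pairing of an object with itself. -/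
abbrev internalPairing (X : TensorPowers A) [ExactPairing X X] :
    ExactPairing (R.internalFunctor.obj X) (R.internalFunctor.obj X) where
  coevaluation' := R.internalFunctor.map (η_ X X)
  evaluation' := R.internalFunctor.map (ε_ X X)
  coevaluation_evaluation' := by
    -- Because `F` sends associators and unitors to `1`, the image of a snake identity is the
    -- internal snake identity.
    have h := congrArg (fun f => R.absN (Hom.hom f)) (ExactPairing.coevaluation_evaluation X X)
    simp only [comp_hom, absN_comp, absN_rightUnitor, absN_hom_whiskerLeft,
      absN_hom_whiskerRight, R.absN_iso_inv _ (R.absN_leftUnitor _),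
      R.absN_iso_inv _ (R.absN_associator _ _ _)] at h
    ext
    exact h
  evaluation_coevaluation' := by
    have h := congrArg (fun f => R.absN (Hom.hom f)) (ExactPairing.evaluation_coevaluation X X)
    simp only [comp_hom, absN_comp, absN_leftUnitor, absN_associator, absN_hom_whiskerLeft,
      absN_hom_whiskerRight, R.absN_iso_inv _ (R.absN_rightUnitor _)] at h
    ext
    exact h

/-- The internal PROB has duals. -/
noncomputable abbrev internalRigid : RightRigidCategory (InternalPRO R.Elt) where
  rightDual X :=
    letI := R.tensorPowersPairing ⟨X.len⟩
    { rightDual := X, exact := R.internalPairing ⟨X.len⟩ }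

variable [BalancedCategory C] [RibbonCategory C]

theorem tensorPowers_twistCompatible (X : TensorPowers A) :
    letI := R.tensorPowersPairing X
    TwistCompatible X X := by
  let := R.tensorPowersPairing X
  let := R.tensorPowPairing X.len
  -- The ribbon axiom of `C` concerns the chosen dual of the tensor power; independence of the dual
  -- transfers it to the self-pairing.
  have h : TwistCompatible (tensorPow A X.len) (tensorPow A X.len) :=
    (twistCompatible (tensorPow A X.len)).of_pairing
  have conj : ∀ {U V W : C} (e : V ≅ W) {u : U ⟶ V} {f g : V ⟶ V}, u ≫ f = u ≫ g →
      (u ≫ e.hom) ≫ e.inv ≫ f ≫ e.hom = (u ≫ e.hom) ≫ e.inv ≫ g ≫ e.hom := by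
    intro U V W e u f g h
    simp only [Category.assoc, Iso.hom_inv_id_assoc, reassoc_of% h]
  refine hom_ext ?_
  rw [comp_hom, comp_hom, tensorPowersPairing_coevaluation_hom]
  exact conj (powAdd A X.len X.len) h

theorem tensorPowers_ribbon :
    letI := R.tensorPowersRigid
    RibbonCategory (TensorPowers A) :=
  letI := R.tensorPowersRigid
  ribbonCategory_of_twistCompatible R.tensorPowers_twistCompatible

/-- Compatibility of twist and pairing is an equation in `C|_A`. Its image under `F` is the required
one, since `F` preserves whiskering and twist and the internal pairing is the image of the one in
`C|_A`. -/
theorem internal_ribbon :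
    letI := R.internalRigid
    RibbonCategory (InternalPRO R.Elt) := by
  let := R.internalRigid
  refine ribbonCategory_of_twistCompatible fun X => ?_
  let := R.tensorPowersPairing ⟨X.len⟩
  have h := congrArg (fun f => R.absN (Hom.hom f)) (R.tensorPowers_twistCompatible ⟨X.len⟩)
  simp only [comp_hom, absN_comp, absN_hom_whiskerLeft, absN_hom_whiskerRight, absN_twist] at h
  exact InternalPRO.hom_ext h

end ReflexiveObject

end Duals

/-! ### The theorem -/

theorem mainTheorem4 {C : Type*} [Category C] [MonoidalCategory C]
    [BraidedCategory C] [BalancedCategory C] [RightRigidCategory C] [RibbonCategory C]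
    (A : C) (R : ReflexiveObject A) (hA : loop A = 𝟙 (𝟙_ C)) :
    (∀ (X Y : TensorPowers A) (f : X ⟶ Y),
      (InternalPRO.val (R.internalFunctor.map f)).hom =
        trace A ((λ_ A).hom ≫ R.lamN X.len ≫ (R.lam ⊗ₘ TensorPowers.Hom.hom f) ≫
          (α_ A A (tensorPow A Y.len)).hom ≫ A ◁ R.appN Y.len)) ∧
    R.internalFunctor.Full ∧ R.internalFunctor.Faithful ∧ R.internalFunctor.IsEquivalence ∧
    (∃ _ : RightRigidCategory (TensorPowers A), RibbonCategory (TensorPowers A)) ∧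
    (∃ _ : RightRigidCategory (InternalPRO R.Elt), RibbonCategory (InternalPRO R.Elt)) ∧
    (∃ _ : R.internalFunctor.Braided,
      InternalPRO.val (Functor.LaxMonoidal.ε R.internalFunctor) = I ∧
      ∀ X Y : TensorPowers A,
        InternalPRO.val (Functor.LaxMonoidal.μ R.internalFunctor X Y) = I) ∧
    (∀ X : TensorPowers A, R.internalFunctor.map (BalancedCategory.twist X).hom =
      (BalancedCategory.twist (R.internalFunctor.obj X)).hom) := by
  -- The loop is also `η';ε`, so its triviality makes `η'` the section `c` of `ε` needed for
  -- cancelling `A ⊗ _`.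
  have hc : revCoev A Aᘁ ≫ ε_ A Aᘁ = 𝟙 _ := by rw [← loop_eq, hA]
  have hFull := R.internalFunctor_full hc
  have hFaithful := R.internalFunctor_faithful hc
  exact ⟨fun X Y f => R.absN_hom_eq_trace (TensorPowers.Hom.hom f), hFull, hFaithful, { },
    ⟨R.tensorPowersRigid, R.tensorPowers_ribbon⟩, ⟨R.internalRigid, R.internal_ribbon⟩,
    ⟨inferInstance, R.val_ε, R.val_μ⟩, R.internalFunctor_map_twist⟩
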